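/- Let $K$ be an $n$-dimensional simplicial complex in which every simplex is a face of an $n$-simplex, with the metric for which every simplex is a regular Euclidean simplex with edges of length $1$. Assume that $K$ has bounded geometry, i.e. $K$ is connected and there is a bound for the number of edges at a vertex, and that $K$ is not compact. Let $\pi=\langle p_0,p_1,\dots\rangle$ with $1<p_i<\infty$ (the $p_i$ with $i>n$ play no role, since there are no nonzero forms of degree $>n$). For exponents $p,q$ let $S\mathscr L^k_{p,q}(K)$ be the Banach space obtained as the closure of the space of Lipschitz $k$-forms on $K$ (finite sums $\sum f_0\,df_1\wedge\dots\wedge df_k$ with Lipschitz functions $f_i$ on $K$) that are smooth on each closed simplex, with respect to the norm $$\Big(\sum_{T}\sup_T|\omega|^{p}\Big)^{1/p}+\Big(\sum_{T}\sup_T|d\omega|^{q}\Big)^{1/q},$$ the sums being over the $n$-simplices $T$ of $K$, and put $S\mathscr L^k_\pi=S\mathscr L^k_{p_k,p_{k+1}}(K)$. Let $d\colon S\mathscr L^k_{p,q}\to S\mathscr L^{k+1}_{q,r}$ be the (bounded) exterior differential, and let $\mathscr I$ be the de Rham map from $S\mathscr L^k_{p,q}$ to simplicial $k$-cochains, $\mathscr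 I(\omega)(\sigma)=\int_\sigma\omega$. Write $\ker^k\mathscr I\subset S\mathscr L^k_\pi$ for its kernel. Suppose that $k+1\le n$ and $p_k<p_{k+1}$. Then: 1. There is no linear map $\Phi\colon\ker^{k+1}\mathscr I\to d\big(S\mathscr L^k_\pi\big)$ whose composition with the inclusion $d\big(S\mathscr L^k_\pi\big)\hookrightarrow S\mathscr L^{k+1}_\pi$ is the inclusion $\ker^{k+1}\mathscr I\hookrightarrow S\mathscr L^{k+1}_\pi$. 2. For an ordered $(k+1)$-simplex $\sigma=(v_0,\dots,v_{k+1})$ of $K$ with barycenter $b_\sigma$ let $\beta_\sigma$ be the following $k$-form, supported in the star of $b_\sigma$ in the barycentric subdivision of $K$. Let $\Psi(y)=\exp\big(\tfrac1{|y|^2-1}\big)$ for $|y|<1$ and $\Psi(y)=0$ otherwise, let $\rho=\tfrac1{2(k+2)}$, and let $x_0,\dots,x_k$ be the barycentric coordinates belonging to $v_1,\dots,v_{k+1}$. On every $n$-simplex containing $\sigma$, $$\beta_\sigma=\Psi\Big(\frac{x-b_\sigma}{\rho}\Big)\sum_{0\le l_0<\dots<l_{k-1}\le k}dx_{l_0}\wedge\dots\wedge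 dx_{l_{k-1}},$$ and $\beta_\sigma=0$ on all the other $n$-simplices. There are sequences $(\sigma_i)_{i\ge1}$ of ordered $(k+1)$-simplices of $K$ with pairwise distinct vertex sets; and for every such sequence and every $0<\varepsilon<p_{k+1}-p_k$, the $\beta_{\sigma_i}$ lie in $S\mathscr L^k_{p_{k+1},p_{k+1}}(K)$, the series $$\omega=\sum_{i=1}^\infty\Big(\frac1i\Big)^{\frac1{p_{k+1}-\varepsilon}}\beta_{\sigma_i}$$ converges in $S\mathscr L^k_{p_{k+1},p_{k+1}}(K)$, $d\omega\in\ker^{k+1}\mathscr I$, and there is no $\eta\in S\mathscr L^k_\pi$ with $d\eta=d\omega$. 3. The complex $\ker\mathscr I$ has nontrivial cohomology in degree $k+1$: the space $\{\theta\in\ker^{k+1}\mathscr I : d\theta=0\}$ modulo $d(\ker^k\mathscr I)$ is not zero. -/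

import Mathlib

open scoped ENNReal NNReal

noncomputable section

namespace LipDeRham

/-! ### Metric simplicial complexes with unit edges

A complex is given by its faces; each face carries the metric of the regular Euclidean simplex with
edges of length one. -/

section Complex

variable {V : Type*} [DecidableEq V]

/-- `K` is `n`-dimensional: every simplex is a face of a simplex of dimension `n`
(in particular no simplex has dimension larger than `n`). -/
def IsPure (K : AbstractSimplicialComplex V) (n : ℕ) : Prop :=
  ∀ s ∈ K.faces, ∃ T ∈ K.faces, s ⊆ T ∧ T.card = n + 1

/-- Bounded geometry (all edges having length one): `K` is connected, and there is a bound for the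
number of edges at a vertex. -/
structure BoundedGeometry (K : AbstractSimplicialComplex V) : Prop where
  nonempty : Nonempty V
  connected : ∀ v w : V, Relation.ReflTransGen (fun a b => ({a, b} : Finset V) ∈ K.faces) v w
  starBounded : ∃ N : ℕ, ∀ v : V, {w : V | w ≠ v ∧ ({v, w} : Finset V) ∈ K.faces}.encard ≤ N

/-- The polyhedron `|K|`, in barycentric coordinates. For a star-bounded complex the topology of
pointwise convergence of the barycentric coordinates is that of the path metric. -/
def realization (K : AbstractSimplicialComplex V) : Set (V → ℝ) :=
  {t | ∃ s ∈ K.faces, (∀ v, 0 ≤ t v) ∧ (∀ v, v ∉ s → t v = 0) ∧ ∑ v ∈ s, t v = 1}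

/-- The simplices of dimension `n`. -/
abbrev TopSimplex (K : AbstractSimplicialComplex V) (n : ℕ) : Type _ :=
  {T : Finset V // T ∈ K.faces ∧ T.card = n + 1}

/-- The simplices of dimension `m` with an ordering of the vertices. -/
structure OrderedSimplex (K : AbstractSimplicialComplex V) (m : ℕ) where
  vertex : Fin (m + 1) → V
  injective : Function.Injective vertex
  mem_faces : Finset.univ.image vertex ∈ K.faces

/-- The set of vertices of an ordered simplex. -/
def OrderedSimplex.face {K : AbstractSimplicialComplex V} {m : ℕ} (s : OrderedSimplex K m) :
    Finset V :=
  Finset.univ.image s.vertex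

/-- The vectors of coordinate sum zero. -/
def dirSubmodule (T : Finset V) : Submodule ℝ (EuclideanSpace ℝ T) where
  carrier := {x | ∑ i, x i = 0}
  add_mem' := by
    intro a b ha hb
    change ∑ i, (a i + b i) = 0
    rw [Finset.sum_add_distrib, show ∑ i, a i = 0 from ha, show ∑ i, b i = 0 from hb, add_zero]
  zero_mem' := by simp
  smul_mem' := by
    intro c x hx
    change ∑ i, c * x i = 0
    rw [← Finset.mul_sum, show ∑ i, x i = 0 from hx, mul_zero]

/-- The direction space of the simplex `T`, a Euclidean space of dimension one less than the number
of vertices of `T`. -/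
def Dir (T : Finset V) : Type _ := dirSubmodule T

instance (T : Finset V) : NormedAddCommGroup (Dir T) :=
  inferInstanceAs (NormedAddCommGroup (dirSubmodule T))

instance (T : Finset V) : InnerProductSpace ℝ (Dir T) :=
  inferInstanceAs (InnerProductSpace ℝ (dirSubmodule T))

instance (T : Finset V) : FiniteDimensional ℝ (Dir T) :=
  inferInstanceAs (FiniteDimensional ℝ (dirSubmodule T))

instance (T : Finset V) : MeasurableSpace (Dir T) := borel _

instance (T : Finset V) : BorelSpace (Dir T) := ⟨rfl⟩

/-- The vertices of the regular simplex with unit edges and barycenter `0` in `Dir T`. -/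
def vtx (T : Finset V) (a : T) : Dir T :=
  ⟨WithLp.toLp 2 fun i => ((if i = a then 1 else 0) - (T.card : ℝ)⁻¹) / √2, by
    have h : (T.card : ℝ) ≠ 0 := by
      have := Finset.card_pos.2 ⟨a.1, a.2⟩
      positivity
    change ∑ i : T, ((if i = a then (1 : ℝ) else 0) - (T.card : ℝ)⁻¹) / √2 = 0
    rw [← Finset.sum_div, Finset.sum_sub_distrib]
    simp [h]⟩

/-- The closed regular simplex with unit edges. -/
def simplex (T : Finset V) : Set (Dir T) := convexHull ℝ (Set.range (vtx T))

instance (T : Finset V) : CompactSpace (simplex T) :=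
  isCompact_iff_compactSpace.1 ((Set.finite_range (vtx T)).isCompact_convexHull (𝕜 := ℝ))

/-- The barycentric coordinates of a point of the affine span of the simplex `T`. -/
def bary (T : Finset V) (x : Dir T) (v : V) : ℝ :=
  if h : v ∈ T then (T.card : ℝ)⁻¹ + √2 * x.1 ⟨v, h⟩ else 0

/-- The differential of the barycentric coordinate of the vertex `v` of `T`. -/
def dbary (T : Finset V) (v : T) (u : Dir T) : ℝ := √2 * u.1 v

/-! ### Lipschitz forms -/

/-- The map `(a, b) ↦ (b, 0)`, for norms `‖a‖ + ‖b‖`. -/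
def shiftCLM (A B C : Type*) [NormedAddCommGroup A] [NormedSpace ℝ A] [NormedAddCommGroup B]
    [NormedSpace ℝ B] [NormedAddCommGroup C] [NormedSpace ℝ C] :
    WithLp 1 (A × B) →L[ℝ] WithLp 1 (B × C) :=
  (WithLp.prodContinuousLinearEquiv 1 ℝ B C).symm.toContinuousLinearMap.comp
    ((ContinuousLinearMap.inl ℝ B C).comp
      ((ContinuousLinearMap.snd ℝ A B).comp
        (WithLp.prodContinuousLinearEquiv 1 ℝ A B).toContinuousLinearMap))


/-- Alternating `k`-forms on the direction space of `T`, with the comass norm. -/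
abbrev Alt (T : Finset V) (k : ℕ) : Type _ := (Dir T) [⋀^Fin k]→L[ℝ] ℝ

/-- Continuous `k`-forms on the closed simplex `T`, with the sup norm. -/
abbrev Form (T : Finset V) (k : ℕ) : Type _ := C(simplex T, Alt T k)

/-- Lipschitz functions on `|K|` for the path metric, that is, functions which are Lipschitz on each
simplex, with the same constant (only the values on `|K|` matter). -/
def IsLipschitz (K : AbstractSimplicialComplex V) (n : ℕ) (f : (V → ℝ) → ℝ) : Prop :=
  ∃ C : ℝ≥0, ∀ T : TopSimplex K n, LipschitzOnWith C (fun x => f (bary T.1 x)) (simplex T.1)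

/-- The value of `df₁ ∧ ⋯ ∧ dfₘ` on the simplex `T` at the point `x` and the vectors `u`. -/
def wedge (T : Finset V) {m : ℕ} (f : Fin m → (V → ℝ) → ℝ) (x : Dir T) (u : Fin m → Dir T) : ℝ :=
  (Matrix.of fun a b : Fin m => fderiv ℝ (fun y : Dir T => f a (bary T y)) x (u b)).det

/-- `α` is a Lipschitz form which is smooth on each simplex, and `β = dα`: on each
`T` of top dimension `α` is the restriction of a smooth form `F`, `β` is the restriction of `dF`,
and for finitely many tuples of Lipschitz functions,
`α = ∑ f₀ df₁ ∧ ⋯ ∧ dfₖ` and `β = ∑ df₀ ∧ df₁ ∧ ⋯ ∧ dfₖ` almost everywhere. -/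
def IsSmoothLipschitz (K : AbstractSimplicialComplex V) (n k : ℕ)
    (α : ∀ T : TopSimplex K n, Form T.1 k) (β : ∀ T : TopSimplex K n, Form T.1 (k + 1)) : Prop :=
  ∃ F : ∀ T : TopSimplex K n, Dir T.1 → Alt T.1 k,
    (∀ T, ContDiff ℝ (⊤ : ℕ∞) (F T)) ∧
    (∀ T, ∀ x : simplex T.1, α T x = F T x) ∧
    (∀ T, ∀ x : simplex T.1, β T x = extDeriv (F T) x) ∧
    ∃ (ι : Type) (_ : Fintype ι) (f : ι → Fin (k + 1) → (V → ℝ) → ℝ),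
      (∀ j a, IsLipschitz K n (f j a)) ∧
      ∀ T : TopSimplex K n,
        ∀ᵐ x ∂(MeasureTheory.volume : MeasureTheory.Measure (Dir T.1)).restrict (simplex T.1),
          (∀ u, F T x u = ∑ j, f j 0 (bary T.1 x) * wedge T.1 (fun a => f j a.succ) x u) ∧
          (∀ u, extDeriv (F T) x u = ∑ j, wedge T.1 (f j) x u)

/-! ### The Banach spaces `SLᵏ` -/

/-- Families of continuous `k`-forms on the simplices of top dimension with
`(∑_T sup_T |ω|^p)^{1/p}` finite, normed by this quantity. -/
def LpForms (K : AbstractSimplicialComplex V) (n k : ℕ) (p : ℝ≥0∞) : Type _ :=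
  lp (fun T : TopSimplex K n => Form T.1 k) p

instance (K : AbstractSimplicialComplex V) (n k : ℕ) (p : ℝ≥0∞) [Fact (1 ≤ p)] :
    NormedAddCommGroup (LpForms K n k p) :=
  inferInstanceAs (NormedAddCommGroup (lp (fun T : TopSimplex K n => Form T.1 k) p))

instance (K : AbstractSimplicialComplex V) (n k : ℕ) (p : ℝ≥0∞) [Fact (1 ≤ p)] :
    NormedSpace ℝ (LpForms K n k p) :=
  inferInstanceAs (NormedSpace ℝ (lp (fun T : TopSimplex K n => Form T.1 k) p))

/-- The form on the simplex `T`. -/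
def LpForms.on {K : AbstractSimplicialComplex V} {n k : ℕ} {p : ℝ≥0∞} (w : LpForms K n k p)
    (T : TopSimplex K n) : Form T.1 k :=
  w.1 T

@[simp] theorem LpForms.add_on {K : AbstractSimplicialComplex V} {n k : ℕ} {p : ℝ≥0∞}
    [Fact (1 ≤ p)] (w z : LpForms K n k p) (T : TopSimplex K n) : (w + z).on T = w.on T + z.on T :=
  rfl

@[simp] theorem LpForms.smul_on {K : AbstractSimplicialComplex V} {n k : ℕ} {p : ℝ≥0∞}
    [Fact (1 ≤ p)] (c : ℝ) (w : LpForms K n k p) (T : TopSimplex K n) :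
    (c • w).on T = c • w.on T :=
  rfl

@[simp] theorem LpForms.zero_on {K : AbstractSimplicialComplex V} {n k : ℕ} {p : ℝ≥0∞}
    [Fact (1 ≤ p)] (T : TopSimplex K n) : (0 : LpForms K n k p).on T = 0 :=
  rfl

/-- Pairs `(ω, η)` of a `k`-form and a `(k+1)`-form, with the norm `‖ω‖_p + ‖η‖_q`. -/
abbrev Pairs (K : AbstractSimplicialComplex V) (n k : ℕ) (p q : ℝ≥0∞) : Type _ :=
  WithLp 1 (LpForms K n k p × LpForms K n (k + 1) q)

variable (K : AbstractSimplicialComplex V) (n k : ℕ) (p q r : ℝ≥0∞)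
  [Fact (1 ≤ p)] [Fact (1 ≤ q)] [Fact (1 ≤ r)]

instance : NormedAddCommGroup (Pairs K n k p q) := inferInstance

instance : NormedSpace ℝ (Pairs K n k p q) := inferInstance

/-- The pairs `(ω, dω)` of finite norm with `ω` a Lipschitz form that is smooth on each simplex. -/
def smoothPairs : Submodule ℝ (Pairs K n k p q) where
  carrier := {z | IsSmoothLipschitz K n k z.fst.on z.snd.on}
  add_mem' := by
    rintro z w ⟨F, hF, h1, h2, ι, _, f, hf, h3⟩ ⟨G, hG, g1, g2, κ, _, g, hg, g3⟩
    have hadd : ∀ T x, extDeriv (F T + G T) x = extDeriv (F T) x + extDeriv (G T) x := fun T x =>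
      extDeriv_add ((hF T).differentiable (by simp) x) ((hG T).differentiable (by simp) x)
    refine ⟨fun T => F T + G T, fun T => (hF T).add (hG T), ?_, ?_, ι ⊕ κ, inferInstance,
      Sum.elim f g, ?_, ?_⟩
    · intro T x
      simp [← h1, ← g1]
    · intro T x
      rw [hadd, ← h2, ← g2]
      simp
    · rintro (j | j) a
      · exact hf j a
      · exact hg j a
    · intro T
      filter_upwards [h3 T, g3 T] with x hx gx
      refine ⟨fun u => ?_, fun u => ?_⟩
      · simp [hx.1 u, gx.1 u]
      · rw [hadd]
        simp [hx.2 u, gx.2 u]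
  zero_mem' := by
    refine ⟨fun T => 0, fun T => contDiff_const, ?_, ?_, Empty, inferInstance, fun j => j.elim,
      fun j => j.elim, ?_⟩
    · intro T x
      simp
    · intro T x
      have : extDeriv (0 : Dir T.1 → Alt T.1 k) x = 0 := by
        have := extDeriv_smul (x := (x : Dir T.1)) (0 : ℝ) (0 : Dir T.1 → Alt T.1 k)
        simpa using this
      rw [this]
      simp
    · intro T
      refine Filter.Eventually.of_forall fun x => ⟨fun u => by simp, fun u => ?_⟩
      have : extDeriv (0 : Dir T.1 → Alt T.1 k) x = 0 := by
        have := extDeriv_smul (x := (x : Dir T.1)) (0 : ℝ) (0 : Dir T.1 → Alt T.1 k)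
        simpa using this
      rw [this]
      simp
  smul_mem' := by
    rintro c z ⟨F, hF, h1, h2, ι, _, f, hf, h3⟩
    refine ⟨fun T => c • F T, fun T => contDiff_const.smul (hF T), ?_, ?_, ι, inferInstance,
      fun j => Fin.cons (fun t => c * f j 0 t) (fun a => f j a.succ), ?_, ?_⟩
    · intro T x
      simp [← h1]
    · intro T x
      rw [extDeriv_smul, ← h2]
      simp
    · intro j a
      refine Fin.cases ?_ (fun b => ?_) a
      · obtain ⟨C, hC⟩ := hf j 0
        refine ⟨‖c‖₊ * C, fun T => ?_⟩
        simp only [Fin.cons_zero]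
        refine LipschitzOnWith.of_dist_le_mul fun x hx y hy => ?_
        have := (hC T).dist_le_mul x hx y hy
        rw [Real.dist_eq] at this ⊢
        rw [← mul_sub, abs_mul, NNReal.coe_mul, mul_assoc]
        exact mul_le_mul_of_nonneg_left this (abs_nonneg c)
      · simpa using hf j b.succ
    · intro T
      filter_upwards [h3 T] with x hx
      refine ⟨fun u => ?_, fun u => ?_⟩
      · simp [hx.1 u, Finset.mul_sum, mul_assoc]
      · rw [extDeriv_smul]
        simp only [ContinuousAlternatingMap.smul_apply, hx.2 u, smul_eq_mul, Finset.mul_sum]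
        refine Finset.sum_congr rfl fun j _ => ?_
        unfold wedge
        rw [Matrix.det_succ_row_zero, Matrix.det_succ_row_zero, Finset.mul_sum]
        refine Finset.sum_congr rfl fun b _ => ?_
        have h0 : fderiv ℝ (fun y : Dir T.1 => c * f j 0 (bary T.1 y)) x =
            c • fderiv ℝ (fun y : Dir T.1 => f j 0 (bary T.1 y)) x :=
          congrFun (fderiv_const_smul_field (𝕜 := ℝ) c) x
        have h1 : ∀ A B : Matrix (Fin k) (Fin k) ℝ, A = B → ∀ d e : ℝ,
            c * ((-1) ^ (b : ℕ) * d * A.det) = (-1) ^ (b : ℕ) * (c * d) * B.det := by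
          rintro A _ rfl d e
          ring
        simp only [Matrix.of_apply, Fin.cons_zero, h0]
        exact h1 _ _ (by ext; simp) _ 0

/-- The space `SLᵏ` with exponents `p, q`: the closure of the space of Lipschitz `k`-forms that are
smooth on each simplex, for the norm
`(∑_T sup_T |ω|^p)^{1/p} + (∑_T sup_T |dω|^q)^{1/q}`, the sums being over the simplices of top
dimension. An element `ω` of the closure is stored together with `dω`. -/
def SL : Type _ := (smoothPairs K n k p q).topologicalClosure

instance : NormedAddCommGroup (SL K n k p q) :=
  inferInstanceAs (NormedAddCommGroup (smoothPairs K n k p q).topologicalClosure)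

instance : NormedSpace ℝ (SL K n k p q) :=
  inferInstanceAs (NormedSpace ℝ (smoothPairs K n k p q).topologicalClosure)

variable {K n k p q r} in
/-- The form underlying an element of `SLᵏ`. -/
def formOf (w : SL K n k p q) (T : TopSimplex K n) : Form T.1 k := w.1.fst.on T

/-- The map `(ω, η) ↦ (η, 0)`. -/
def shift : Pairs K n k p q →L[ℝ] Pairs K n (k + 1) q r :=
  shiftCLM (LpForms K n k p) (LpForms K n (k + 1) q) (LpForms K n (k + 1 + 1) r)

theorem shift_mem_smoothPairs (z : Pairs K n k p q) (hz : z ∈ smoothPairs K n k p q) :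
    shift K n k p q r z ∈ smoothPairs K n (k + 1) q r := by
  obtain ⟨F, hF, h1, h2, ι, _, f, hf, h3⟩ := hz
  have hdd : ∀ T x, extDeriv (extDeriv (F T)) x = 0 := fun T x => by
    rw [extDeriv_extDeriv (hF T) (by
      rw [minSmoothness_of_isRCLikeNormedField]
      exact WithTop.coe_le_coe.2 (le_top : (2 : ℕ∞) ≤ ⊤))]
    rfl
  refine ⟨fun T => extDeriv (F T), fun T => ?_, h2, fun T x => ?_, ι, inferInstance,
    fun j => Fin.cons (fun _ => 1) (f j), ?_, ?_⟩
  · have h : ContDiff ℝ (⊤ : ℕ∞) (fderiv ℝ (F T)) := (hF T).fderiv_right (by simp)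
    exact (ContinuousAlternatingMap.alternatizeUncurryFinCLM ℝ (Dir T.1) ℝ).contDiff.comp h
  · change (0 : LpForms K n (k + 1 + 1) r).on T x = _
    rw [hdd]
    rfl
  · intro j a
    refine Fin.cases ?_ (fun b => ?_) a
    · exact ⟨0, fun T => by simp⟩
    · simpa using hf j b
  · intro T
    filter_upwards [h3 T] with x hx
    refine ⟨fun u => ?_, fun u => ?_⟩
    · simp [hx.2 u]
    · rw [hdd]
      change (0 : ℝ) = _
      refine (Finset.sum_eq_zero fun j _ => ?_).symm
      exact Matrix.det_eq_zero_of_row_eq_zero 0 fun b => by simp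

/-- The differential `d : SLᵏ → SLᵏ⁺¹`, a bounded operator. -/
def d : SL K n k p q →L[ℝ] SL K n (k + 1) q r :=
  ((shift K n k p q r).comp (smoothPairs K n k p q).topologicalClosure.subtypeL).codRestrict
    (smoothPairs K n (k + 1) q r).topologicalClosure fun w =>
    map_mem_closure (s := (smoothPairs K n k p q : Set (Pairs K n k p q)))
      (shift K n k p q r).continuous w.2 (shift_mem_smoothPairs K n k p q r)

/-! ### The de Rham map -/

/-- The points `(s₁, …, sₘ)` with `sⱼ ≥ 0` and `∑ sⱼ ≤ 1`. -/
def corner (m : ℕ) : Set (Fin m → ℝ) := {s | (∀ j, 0 ≤ s j) ∧ ∑ j, s j ≤ 1}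

/-- The affine parametrization of the face of `T` with vertices `v₀, …, vₘ`. -/
def param (T : Finset V) {m : ℕ} (v : Fin (m + 1) → T) (s : Fin m → ℝ) : Dir T :=
  (1 - ∑ j, s j) • vtx T (v 0) + ∑ j, s j • vtx T (v j.succ)

theorem isCompact_corner (m : ℕ) : IsCompact (corner m) := by
  refine (isCompact_Icc (a := (0 : Fin m → ℝ)) (b := 1)).of_isClosed_subset ?_ ?_
  · have h : corner m = (⋂ j, {s | 0 ≤ s j}) ∩ {s | ∑ j, s j ≤ 1} := by
      ext s
      simp [corner]
    rw [h]
    exact (isClosed_iInter fun j => isClosed_le continuous_const (continuous_apply j)).inter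
      (isClosed_le (by fun_prop) continuous_const)
  · intro s hs
    exact ⟨fun j => hs.1 j, fun j =>
      (Finset.single_le_sum (fun i _ => hs.1 i) (Finset.mem_univ j)).trans hs.2⟩

theorem param_mem (T : Finset V) {m : ℕ} (v : Fin (m + 1) → T) {s : Fin m → ℝ}
    (hs : s ∈ corner m) : param T v s ∈ simplex T := by
  have h := (convex_convexHull ℝ (Set.range (vtx T))).sum_mem (t := Finset.univ)
    (w := Fin.cons (1 - ∑ j, s j) s) (z := fun i => vtx T (v i)) (fun i _ => ?_) ?_
    (fun i _ => subset_convexHull ℝ _ ⟨v i, rfl⟩)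
  · simpa [Fin.sum_univ_succ, param, simplex] using h
  · refine Fin.cases ?_ (fun j => ?_) i
    · simpa using hs.2
    · simpa using hs.1 j
  · simp [Fin.sum_univ_succ]

/-- The integral of an `m`-form over the face of `T` with vertices `v₀, …, vₘ`, oriented by this
ordering: `∫ φ(γ(s)) (∂γ/∂s₁, …, ∂γ/∂sₘ) ds` for the affine parametrization `γ`. -/
def faceIntegral (T : Finset V) {m : ℕ} (v : Fin (m + 1) → T) (φ : Form T m) : ℝ :=
  ∫ s : corner m, φ ⟨param T v s, param_mem T v s.2⟩ (fun j => vtx T (v j.succ) - vtx T (v 0))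
    ∂(MeasureTheory.Measure.comap Subtype.val MeasureTheory.volume)

instance (m : ℕ) : CompactSpace (corner m) := isCompact_iff_compactSpace.1 (isCompact_corner m)

theorem continuous_integrand (T : Finset V) {m : ℕ} (v : Fin (m + 1) → T) (φ : Form T m) :
    Continuous fun s : corner m =>
      φ ⟨param T v s, param_mem T v s.2⟩ (fun j => vtx T (v j.succ) - vtx T (v 0)) := by
  have h1 : Continuous fun s : corner m => φ ⟨param T v s, param_mem T v s.2⟩ := by
    refine φ.continuous.comp (Continuous.subtype_mk ?_ _)
    unfold param
    have h0 : ∀ j : Fin m, Continuous fun s : corner m => (s : Fin m → ℝ) j := fun j =>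
      (continuous_apply j).comp continuous_subtype_val
    exact ((continuous_const.sub (continuous_finsetSum _ fun j _ => h0 j)).smul
      continuous_const).add (continuous_finsetSum _ fun j _ => (h0 j).smul continuous_const)
  exact (ContinuousAlternatingMap.apply ℝ (Dir T) ℝ _).continuous.comp h1

theorem integrable_integrand (T : Finset V) {m : ℕ} (v : Fin (m + 1) → T) (φ : Form T m) :
    MeasureTheory.Integrable (fun s : corner m =>
      φ ⟨param T v s, param_mem T v s.2⟩ (fun j => vtx T (v j.succ) - vtx T (v 0)))
      (MeasureTheory.Measure.comap Subtype.val MeasureTheory.volume) := by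
  have hfin : MeasureTheory.IsFiniteMeasure
      (MeasureTheory.Measure.comap (Subtype.val : corner m → Fin m → ℝ) MeasureTheory.volume) := by
    refine ⟨?_⟩
    rw [MeasureTheory.Measure.comap_apply _ Subtype.val_injective
      (fun t ht => (isCompact_corner m).measurableSet.subtype_image ht) _ MeasurableSet.univ]
    simpa using (isCompact_corner m).measure_lt_top
  have h := (continuous_integrand T v φ)
  exact h.integrable_of_hasCompactSupport (HasCompactSupport.of_compactSpace _)

theorem faceIntegral_add (T : Finset V) {m : ℕ} (v : Fin (m + 1) → T) (φ ψ : Form T m) :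
    faceIntegral T v (φ + ψ) = faceIntegral T v φ + faceIntegral T v ψ :=
  MeasureTheory.integral_add (integrable_integrand T v φ) (integrable_integrand T v ψ)

theorem faceIntegral_smul (T : Finset V) {m : ℕ} (v : Fin (m + 1) → T) (c : ℝ) (φ : Form T m) :
    faceIntegral T v (c • φ) = c * faceIntegral T v φ :=
  MeasureTheory.integral_const_mul c _

open Classical in
/-- The de Rham map `𝓘 : ω ↦ (σ ↦ ∫_σ ω)`, with values in the simplicial cochains, on ordered
simplices. To integrate over `σ` one restricts to `σ` the form on any `T` of top dimension
containing `σ`; the restrictions of a Lipschitz form from different `T` agree, hence so do those of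
a uniform limit. -/
def deRham : SL K n k p q →ₗ[ℝ] (OrderedSimplex K k → ℝ) where
  toFun w σ :=
    if h : ∃ T : TopSimplex K n, ∀ i, σ.vertex i ∈ T.1 then
      faceIntegral h.choose.1 (fun i => ⟨σ.vertex i, h.choose_spec i⟩) (formOf w h.choose)
    else 0
  map_add' w z := by
    ext σ
    by_cases h : ∃ T : TopSimplex K n, ∀ i, σ.vertex i ∈ T.1
    · simp only [dif_pos h, Pi.add_apply]
      exact faceIntegral_add _ _ _ _
    · simp only [dif_neg h, Pi.add_apply, add_zero]
  map_smul' c w := by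
    ext σ
    by_cases h : ∃ T : TopSimplex K n, ∀ i, σ.vertex i ∈ T.1
    · simp only [dif_pos h, Pi.smul_apply]
      exact faceIntegral_smul _ _ _ _
    · simp only [dif_neg h, Pi.smul_apply, smul_zero]

/-- The kernel of `𝓘` in degree `k`. -/
def kerI : Submodule ℝ (SL K n k p q) := LinearMap.ker (deRham K n k p q)

/-- The cohomology of the complex `ker 𝓘` in degree `k + 1`, for the exponents
`π = (p₀, p₁, …)`: the closed elements of `ker 𝓘` in degree `k + 1`, modulo the differentials of
the elements of `ker 𝓘` in degree `k`. -/
abbrev KerCohomologySucc (π : ℕ → ℝ≥0∞) [∀ i, Fact (1 ≤ π i)] : Type _ :=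
  let Z : Submodule ℝ (SL K n (k + 1) (π (k + 1)) (π (k + 2))) :=
    kerI K n (k + 1) (π (k + 1)) (π (k + 2)) ⊓
      LinearMap.ker (d K n (k + 1) (π (k + 1)) (π (k + 2)) (π (k + 3))).toLinearMap
  let B : Submodule ℝ (SL K n (k + 1) (π (k + 1)) (π (k + 2))) :=
    (kerI K n k (π k) (π (k + 1))).map (d K n k (π k) (π (k + 1)) (π (k + 2))).toLinearMap
  Z ⧸ B.comap Z.subtype

/-! ### Bump forms on barycentric stars -/

/-- The profile `exp (1 / (r² - 1))` for `r < 1`, and `0` otherwise, of a bump function. -/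
def bump (r : ℝ) : ℝ := if r < 1 then Real.exp (1 / (r ^ 2 - 1)) else 0

variable {K n k}

/-- `β` is the bump form of the ordered simplex `σ = (v₀, …, vₖ₊₁)`, a `k`-form supported in the
star of the barycenter `b` of `σ` in the barycentric subdivision. With the barycentric
coordinates `x₀, …, xₖ` of the vertices `v₁, …, vₖ₊₁` it is
`exp (1 / (|(x - b)/ρ|² - 1)) · ∑ dx_{l₁} ∧ ⋯ ∧ dx_{lₖ}` over `0 ≤ l₁ < ⋯ < lₖ ≤ k`, where
`ρ = 1 / (2 (k + 2))`, on the points with `|x - b| < ρ` of the simplices containing `σ`, and it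
vanishes elsewhere. -/
def IsBumpForm (σ : OrderedSimplex K (k + 1)) (β : ∀ T : TopSimplex K n, Form T.1 k) : Prop :=
  ∀ (T : TopSimplex K n) (x : simplex T.1) (u : Fin k → Dir T.1),
    (∀ h : ∀ i, σ.vertex i ∈ T.1,
      β T x u =
        bump (2 * (k + 2) *
          ‖(x : Dir T.1) - (1 / (k + 2) : ℝ) • ∑ i, vtx T.1 ⟨σ.vertex i, h i⟩‖) *
        ∑ j : Fin (k + 1), (Matrix.of fun a b : Fin k =>
          dbary T.1 ⟨σ.vertex (j.succAbove a).succ, h _⟩ (u b)).det) ∧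
    ((¬ ∀ i, σ.vertex i ∈ T.1) → β T x u = 0)

end Complex
end LipDeRham
end

/-!
The kernel of the de Rham map contains differentials `dω` of forms `ω` that decay at infinity just
fast enough to be summable for the exponent `p (k + 1)`; no form that is summable for the smaller
exponent `p k` has the same differential.

Take infinitely many `(k + 1)`-simplices `σᵢ`; there are such since the complex is not compact and
every vertex lies in a simplex of top dimension (`exists_injective_face`). The bump form `βᵢ` is
`Ψᵢ ∑ dx_{l₁} ∧ ⋯ ∧ dx_{lₖ}`, where `Ψᵢ` is supported in the open star of `σᵢ`
(`pos_of_bumpFun_ne_zero`). Written in barycentric coordinates, `Ψᵢ` is given by one formula on all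
simplices, which shows at once that `βᵢ` is a smooth Lipschitz form (`isSmoothLipschitz_bumpForm`);
and `βᵢ`, `dβᵢ` are bounded uniformly in `i` (`exists_norm_bumpForm_le`). As every simplex of top
dimension meets boundedly many of the supports, and conversely, `∑ aᵢ βᵢ` converges as soon as
`∑ aᵢ^{p (k + 1)}` does (`summable_smul_bumpSL`).

On a simplex of dimension `k + 1` the form `βᵢ` has compact support in the interior or is zero, so
that `∫ dβᵢ = 0` over it by Stokes' theorem, and `d(∑ aᵢ βᵢ)` is in the kernel of the de Rham map
(`d_mem_kerI_of_hasSum`).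

Now let `dη = d(∑ aᵢ βᵢ)`. On `σᵢ` only `βᵢ` contributes to the right-hand side. For a function `χ`
with support in `σᵢ`, Stokes' theorem gives `∫ χ dη = -∫ dχ ∧ η`, an identity which passes from
smooth forms to their limits in the form of the bound `|∫ χ dη| ≤ C sup |η|`
(`exists_abs_weightedIntegral_dEvalOn_le`). If `χ` is the coefficient of `dβᵢ` on `σᵢ`, then
`∫ χ dη = aᵢ ∫ χ²`, where `∫ χ²` is positive and depends on `k` only. Hence `sup |η|` is at least a
fixed multiple of `aᵢ` on each simplex containing `σᵢ` (`exists_mul_le_norm_formOf`), and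
`∑ aᵢ^{p k}` converges. For `aᵢ = i^{-1/(p (k + 1) - ε)}` with `0 < ε < p (k + 1) - p k` the series
with the exponent `p (k + 1)` converges and the one with the exponent `p k` does not
(`exists_bumpSeries`). So `dω ∈ ker 𝓘` is not in `d(SLᵏ)`, which also excludes the linear map `Φ`,
and `dω` represents a nonzero cohomology class.
-/

noncomputable section

namespace LipDeRham

variable {V : Type*} [DecidableEq V]
variable {K : AbstractSimplicialComplex V} {k n : ℕ}

/-! ### Barycentric coordinates -/

/-- The differential of the barycentric coordinate of `v`, which is `0` unless `v` is a vertex of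
`T`. -/
def coordL (T : Finset V) (v : V) : Dir T →L[ℝ] ℝ :=
  if h : v ∈ T then √2 • (EuclideanSpace.proj (⟨v, h⟩ : T)).comp (dirSubmodule T).subtypeL else 0

theorem coordL_of_mem {T : Finset V} {v : V} (h : v ∈ T) (u : Dir T) :
    coordL T v u = dbary T ⟨v, h⟩ u := by
  have h1 : coordL T v = √2 • (EuclideanSpace.proj (⟨v, h⟩ : T)).comp (dirSubmodule T).subtypeL :=
    dif_pos h
  rw [h1]
  rfl

theorem coordL_of_notMem {T : Finset V} {v : V} (h : v ∉ T) : coordL T v = 0 := by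
  simp [coordL, h]

theorem norm_coordL_apply_le (T : Finset V) (v : V) (u : Dir T) : |coordL T v u| ≤ √2 * ‖u‖ := by
  by_cases h : v ∈ T
  · rw [coordL_of_mem h, dbary, abs_mul, abs_of_nonneg (Real.sqrt_nonneg 2)]
    exact mul_le_mul_of_nonneg_left (PiLp.norm_apply_le u.1 ⟨v, h⟩) (Real.sqrt_nonneg 2)
  · rw [coordL_of_notMem h]
    simp

theorem bary_eq_add_coordL (T : Finset V) (v : V) (x : Dir T) :
    bary T x v = bary T 0 v + coordL T v x := by
  by_cases h : v ∈ T
  · rw [coordL_of_mem h, dbary, bary, bary, dif_pos h, dif_pos h]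
    change _ = _ + √2 * 0 + _
    ring
  · simp [bary, h, coordL_of_notMem h]

theorem bary_of_notMem {T : Finset V} {v : V} (h : v ∉ T) (x : Dir T) : bary T x v = 0 := by
  simp [bary, h]

theorem bary_sub_bary (T : Finset V) (v : V) (x y : Dir T) :
    bary T x v - bary T y v = coordL T v (x - y) := by
  rw [bary_eq_add_coordL, bary_eq_add_coordL T v y, map_sub]
  ring

theorem hasFDerivAt_bary (T : Finset V) (v : V) (x : Dir T) :
    HasFDerivAt (fun y => bary T y v) (coordL T v) x := by
  have : (fun y => bary T y v) = fun y => bary T 0 v + coordL T v y :=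
    funext (bary_eq_add_coordL T v)
  rw [this]
  exact (coordL T v).hasFDerivAt.const_add _

/-- Barycentric coordinates compute distances: the edges having length one,
`∑ (xᵥ - yᵥ)² = 2 |x - y|²`. -/
theorem sum_sq_bary_sub (T : Finset V) (x y : Dir T) :
    ∑ v ∈ T, (bary T x v - bary T y v) ^ 2 = 2 * ‖x - y‖ ^ 2 := by
  have h : ‖x - y‖ ^ 2 = ∑ i : T, ((x - y).1 i) ^ 2 := by
    change ‖(x - y).1‖ ^ 2 = _
    rw [EuclideanSpace.norm_sq_eq]
    simp
  rw [h, Finset.mul_sum, ← Finset.sum_coe_sort]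
  refine Finset.sum_congr rfl fun i _ => ?_
  rw [bary_sub_bary, coordL_of_mem i.2, dbary, mul_pow, Real.sq_sqrt (by norm_num)]

theorem bary_vtx (T : Finset V) (a : T) (v : V) : bary T (vtx T a) v = if v = a then 1 else 0 := by
  by_cases h : v ∈ T
  · rw [bary, dif_pos h]
    change _ + √2 * (((if (⟨v, h⟩ : T) = a then (1 : ℝ) else 0) - (T.card : ℝ)⁻¹) / √2) = _
    have : √2 ≠ 0 := by positivity
    rw [mul_div_cancel₀ _ this]
    simp only [Subtype.ext_iff]
    ring
  · rw [bary_of_notMem h, if_neg]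
    rintro rfl
    exact h a.2

theorem coordL_vtx_sub (T : Finset V) (a b : T) (v : V) :
    coordL T v (vtx T a - vtx T b) = (if v = a then 1 else 0) - if v = b then 1 else 0 := by
  rw [← bary_sub_bary, bary_vtx, bary_vtx]

theorem bary_affine (T : Finset V) {ι : Type*} (s : Finset ι) (c : ι → ℝ) (x : ι → Dir T)
    (hc : ∑ i ∈ s, c i = 1) (v : V) :
    bary T (∑ i ∈ s, c i • x i) v = ∑ i ∈ s, c i * bary T (x i) v := by
  rw [bary_eq_add_coordL, map_sum]
  have h : ∀ i ∈ s, c i * bary T (x i) v = c i * bary T 0 v + coordL T v (c i • x i) := by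
    intro i _
    rw [bary_eq_add_coordL, map_smul, smul_eq_mul]
    ring
  rw [Finset.sum_congr rfl h, Finset.sum_add_distrib, ← Finset.sum_mul, hc, one_mul]

/-- The barycentric coordinates `(1 - ∑ s, s₁, …, sₘ)` of a point of `ℝᵐ`. -/
def cornerBary {m : ℕ} (s : Fin m → ℝ) : Fin (m + 1) → ℝ := Fin.cons (1 - ∑ j, s j) s

theorem sum_cornerBary {m : ℕ} (s : Fin m → ℝ) : ∑ i, cornerBary s i = 1 := by
  simp [cornerBary, Fin.sum_univ_succ]

theorem mem_corner_iff {m : ℕ} (s : Fin m → ℝ) : s ∈ corner m ↔ ∀ i, 0 ≤ cornerBary s i := by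
  rw [Fin.forall_fin_succ]
  simp [corner, cornerBary, and_comm]

theorem param_eq_sum (T : Finset V) {m : ℕ} (v : Fin (m + 1) → T) (s : Fin m → ℝ) :
    param T v s = ∑ i, cornerBary s i • vtx T (v i) := by
  simp [param, cornerBary, Fin.sum_univ_succ]

theorem bary_param (T : Finset V) {m : ℕ} (v : Fin (m + 1) → T) (s : Fin m → ℝ) (u : V) :
    bary T (param T v s) u = ∑ i, if u = v i then cornerBary s i else 0 := by
  rw [param_eq_sum, bary_affine _ _ _ _ (sum_cornerBary s)]
  simp [bary_vtx]

theorem bary_param_of_forall_ne (T : Finset V) {m : ℕ} (v : Fin (m + 1) → T) (s : Fin m → ℝ)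
    (u : V) (h : ∀ i, (v i : V) ≠ u) : bary T (param T v s) u = 0 := by
  rw [bary_param]
  exact Finset.sum_eq_zero fun i _ => if_neg (h i).symm

theorem bary_param_vertex (T : Finset V) {m : ℕ} (v : Fin (m + 1) → T)
    (hv : Function.Injective v) (s : Fin m → ℝ) (i : Fin (m + 1)) :
    bary T (param T v s) (v i) = cornerBary s i := by
  rw [bary_param, Finset.sum_eq_single i]
  · simp
  · intro j _ hj
    rw [if_neg]
    intro h
    exact hj (hv (Subtype.ext h.symm))
  · simp

/-! ### The bump functions -/

theorem OrderedSimplex.mem_face {m : ℕ} (σ : OrderedSimplex K m) (i : Fin (m + 1)) :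
    σ.vertex i ∈ σ.face :=
  Finset.mem_image_of_mem _ (Finset.mem_univ i)

theorem OrderedSimplex.card_face {m : ℕ} (σ : OrderedSimplex K m) : σ.face.card = m + 1 := by
  rw [OrderedSimplex.face, Finset.card_image_of_injective _ σ.injective]
  simp

theorem OrderedSimplex.face_subset_iff {m : ℕ} (σ : OrderedSimplex K m) (T : Finset V) :
    σ.face ⊆ T ↔ ∀ i, σ.vertex i ∈ T := by
  simp [OrderedSimplex.face, Finset.subset_iff]

/-- The barycentric coordinates of the barycenter of `σ`. -/
def centerBary (σ : OrderedSimplex K (k + 1)) (v : V) : ℝ :=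
  if v ∈ σ.face then 1 / (k + 2) else 0

/-- The function `exp (1 / (|(x - b)/ρ|² - 1))` of the bump form of `σ`, for `|x - b| < ρ`, extended
by `0`, in barycentric coordinates: `|x - b|² = ½ ∑ (xᵥ - bᵥ)²`. The points of `|K|` have finite
support, so that the sum is a finite one. -/
def bumpFun (σ : OrderedSimplex K (k + 1)) (t : V → ℝ) : ℝ :=
  expNegInvGlue (1 - 2 * (k + 2 : ℝ) ^ 2 * ∑' v, (t v - centerBary σ v) ^ 2)

theorem bumpFun_nonneg (σ : OrderedSimplex K (k + 1)) (t : V → ℝ) : 0 ≤ bumpFun σ t :=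
  expNegInvGlue.nonneg _

theorem expNegInvGlue_le_one (x : ℝ) : expNegInvGlue x ≤ 1 := by
  unfold expNegInvGlue
  split_ifs with h
  · exact zero_le_one
  · rw [Real.exp_le_one_iff]
    simpa using (not_le.1 h).le

theorem bumpFun_le_one (σ : OrderedSimplex K (k + 1)) (t : V → ℝ) : bumpFun σ t ≤ 1 :=
  expNegInvGlue_le_one _

theorem tsum_sq_sub_centerBary (σ : OrderedSimplex K (k + 1)) (T : Finset V) (t : V → ℝ)
    (ht : ∀ v ∉ T, t v = 0) :
    ∑' v, (t v - centerBary σ v) ^ 2 = ∑ v ∈ T ∪ σ.face, (t v - centerBary σ v) ^ 2 := by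
  refine tsum_eq_sum fun v hv => ?_
  rw [Finset.mem_union, not_or] at hv
  simp [ht v hv.1, centerBary, hv.2]

/-- If `S` is the sum of the squares `(xᵥ - bᵥ)²` then the bump function vanishes as soon as one
coordinate `x` of a vertex of the simplex is not positive: `|x - b|² ≥ ½ (k + 2)⁻² ≥ ρ²`. -/
theorem expNegInvGlue_eq_zero_of_nonpos (k : ℕ) {x S : ℝ} (hx : x ≤ 0)
    (hS : (x - 1 / (k + 2)) ^ 2 ≤ S) : expNegInvGlue (1 - 2 * (k + 2 : ℝ) ^ 2 * S) = 0 := by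
  refine expNegInvGlue.zero_of_nonpos ?_
  have hk : (0 : ℝ) < k + 2 := by positivity
  have h2 : (1 / (k + 2 : ℝ)) ^ 2 ≤ S := by
    have h3 : (0 : ℝ) < 1 / (k + 2 : ℝ) := by positivity
    nlinarith
  have h4 : (k + 2 : ℝ) ^ 2 * (1 / (k + 2 : ℝ)) ^ 2 = 1 := by
    field_simp
  have h5 := mul_le_mul_of_nonneg_left h2 (sq_nonneg (k + 2 : ℝ))
  linarith

/-- The bump function of `σ` is supported in the open star of `σ`: the radius `ρ` is smaller than
the distance of the barycenter to the faces of `σ`. -/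
theorem pos_of_bumpFun_ne_zero (σ : OrderedSimplex K (k + 1)) (T : Finset V) (t : V → ℝ)
    (ht : ∀ v ∉ T, t v = 0) (h : bumpFun σ t ≠ 0) (v : V) (hv : v ∈ σ.face) : 0 < t v := by
  by_contra hneg
  refine h (expNegInvGlue_eq_zero_of_nonpos k (not_lt.1 hneg) ?_)
  rw [tsum_sq_sub_centerBary σ T t ht]
  have h1 : (t v - centerBary σ v) ^ 2 ≤ ∑ v ∈ T ∪ σ.face, (t v - centerBary σ v) ^ 2 :=
    Finset.single_le_sum (f := fun v => (t v - centerBary σ v) ^ 2) (fun i _ => sq_nonneg _)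
      (Finset.mem_union_right _ hv)
  rwa [centerBary, if_pos hv] at h1

theorem bumpFun_bary_of_not_subset (σ : OrderedSimplex K (k + 1)) {T : Finset V}
    (h : ¬ σ.face ⊆ T) (x : Dir T) : bumpFun σ (bary T x) = 0 := by
  obtain ⟨v, hv, hvT⟩ := Finset.not_subset.1 h
  by_contra h0
  have := pos_of_bumpFun_ne_zero σ T _ (fun v hv => bary_of_notMem hv x) h0 v hv
  rw [bary_of_notMem hvT] at this
  exact lt_irrefl _ this

/-- The barycenter of `σ` as a point of the simplex `T`. -/
def center (σ : OrderedSimplex K (k + 1)) {T : Finset V} (h : σ.face ⊆ T) : Dir T :=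
  (1 / (k + 2) : ℝ) • ∑ i, vtx T ⟨σ.vertex i, h (σ.mem_face i)⟩

theorem bary_center (σ : OrderedSimplex K (k + 1)) {T : Finset V} (h : σ.face ⊆ T) (v : V) :
    bary T (center σ h) v = centerBary σ v := by
  have hk : (k + 2 : ℝ) ≠ 0 := by positivity
  rw [center, Finset.smul_sum, bary_affine _ _ _ _ (by simp; field_simp; ring)]
  simp only [bary_vtx, centerBary]
  rw [← Finset.mul_sum]
  split_ifs with hv
  · obtain ⟨i, -, rfl⟩ := Finset.mem_image.1 hv
    simp [σ.injective.eq_iff]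
  · rw [Finset.sum_eq_zero, mul_zero]
    intro i _
    rw [if_neg]
    rintro rfl
    exact hv (σ.mem_face i)

theorem bumpFun_bary (σ : OrderedSimplex K (k + 1)) {T : Finset V} (h : σ.face ⊆ T) (x : Dir T) :
    bumpFun σ (bary T x) = expNegInvGlue (1 - (2 * (k + 2) * ‖x - center σ h‖) ^ 2) := by
  rw [bumpFun, tsum_sq_sub_centerBary σ T _ (fun v hv => bary_of_notMem hv x),
    Finset.union_eq_left.2 h, Finset.sum_congr rfl fun v _ => by rw [← bary_center σ h],
    sum_sq_bary_sub]
  congr 1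
  ring

theorem bump_eq_expNegInvGlue {r : ℝ} (hr : 0 ≤ r) : bump r = expNegInvGlue (1 - r ^ 2) := by
  unfold bump expNegInvGlue
  by_cases h : r < 1
  · have : 0 < 1 - r ^ 2 := by nlinarith
    rw [if_pos h, if_neg (not_le.2 this)]
    congr 1
    rw [one_div, ← inv_neg]
    congr 1
    ring
  · have : 1 - r ^ 2 ≤ 0 := by nlinarith
    rw [if_neg h, if_pos this]

theorem contDiff_bumpFun (σ : OrderedSimplex K (k + 1)) (T : Finset V) {m : ℕ∞} :
    ContDiff ℝ m fun x => bumpFun σ (bary T x) := by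
  by_cases h : σ.face ⊆ T
  · have : (fun x => bumpFun σ (bary T x)) = fun x =>
        expNegInvGlue (1 - (2 * (k + 2)) ^ 2 * ‖x - center σ h‖ ^ 2) := by
      funext x
      rw [bumpFun_bary σ h, mul_pow]
    rw [this]
    exact expNegInvGlue.contDiff.comp
      (contDiff_const.sub (contDiff_const.mul ((contDiff_id.sub contDiff_const).norm_sq ℝ)))
  · have : (fun x => bumpFun σ (bary T x)) = fun _ => 0 :=
      funext (bumpFun_bary_of_not_subset σ h)
    rw [this]
    exact contDiff_const

theorem exists_lipschitzWith_expNegInvGlue (c : ℝ) (hc : 1 ≤ c) :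
    ∃ C : ℝ≥0, LipschitzWith C fun r : ℝ => expNegInvGlue (1 - (c * r) ^ 2) := by
  refine ContDiff.lipschitzWith_of_hasCompactSupport (𝕂 := ℝ) (n := (1 : ℕ∞)) ?_ ?_ (by simp)
  · refine HasCompactSupport.of_support_subset_isCompact (isCompact_Icc (a := (-1 : ℝ)) (b := 1))
      fun r hr => ?_
    by_contra h
    refine hr (expNegInvGlue.zero_of_nonpos ?_)
    have h1 : 1 ≤ r ^ 2 := by
      by_contra h2
      exact h (abs_le.1 ((sq_le_one_iff_abs_le_one r).1 (not_le.1 h2).le))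
    have h3 : 1 ≤ c ^ 2 := by nlinarith
    nlinarith [mul_pow c r 2]
  · exact expNegInvGlue.contDiff.comp
      (contDiff_const.sub ((contDiff_const.mul contDiff_id).pow 2))

/-- The bump functions are Lipschitz, with a constant that depends on the dimension only. -/
theorem exists_lipschitzWith_bumpFun (V : Type*) [DecidableEq V] (K : AbstractSimplicialComplex V)
    (k : ℕ) : ∃ C : ℝ≥0, ∀ (σ : OrderedSimplex K (k + 1)) (T : Finset V),
      LipschitzWith C fun x => bumpFun σ (bary T x) := by
  obtain ⟨C, hC⟩ := exists_lipschitzWith_expNegInvGlue (2 * (k + 2))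
    (by have : (0 : ℝ) ≤ k := k.cast_nonneg
        linarith)
  refine ⟨C, fun σ T => ?_⟩
  by_cases h : σ.face ⊆ T
  · have : (fun x => bumpFun σ (bary T x)) = (fun r : ℝ =>
        expNegInvGlue (1 - (2 * (k + 2) * r) ^ 2)) ∘ fun x => dist x (center σ h) := by
      funext x
      rw [bumpFun_bary σ h, Function.comp_apply, dist_eq_norm]
    rw [this]
    simpa using hC.comp (LipschitzWith.dist_left (center σ h))
  · have : (fun x => bumpFun σ (bary T x)) = fun _ => 0 :=
      funext (bumpFun_bary_of_not_subset σ h)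
    rw [this]
    exact LipschitzWith.const' 0

theorem fderiv_bumpFun_eq_zero (σ : OrderedSimplex K (k + 1)) {T : Finset V} {x : Dir T}
    (h : bumpFun σ (bary T x) = 0) : fderiv ℝ (fun y => bumpFun σ (bary T y)) x = 0 :=
  IsLocalMin.fderiv_eq_zero (Filter.Eventually.of_forall fun y => by
    simpa [h] using bumpFun_nonneg σ (bary T y))

/-- On the affine span of an ordered simplex `τ` of the dimension of `σ`, the bump function of `σ`
vanishes unless `σ` and `τ` have the same vertices, and even then it is supported in `τ`. -/
theorem bumpFun_param_ne_zero (σ : OrderedSimplex K (k + 1)) (T : Finset V)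
    (v : Fin (k + 1 + 1) → T) (hv : Function.Injective v) (s : Fin (k + 1) → ℝ)
    (h : bumpFun σ (bary T (param T v s)) ≠ 0) :
    s ∈ corner (k + 1) ∧ σ.face = Finset.univ.image fun i => (v i : V) := by
  have hpos := pos_of_bumpFun_ne_zero σ T _ (fun v hv => bary_of_notMem hv _) h
  have hsub : σ.face ⊆ Finset.univ.image fun i => (v i : V) := by
    intro u hu
    by_contra hne
    refine (hpos u hu).ne' (bary_param_of_forall_ne T v s u fun i hi => hne ?_)
    exact Finset.mem_image.2 ⟨i, Finset.mem_univ i, hi⟩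
  have heq := Finset.eq_of_subset_of_card_le hsub (by
    rw [σ.card_face]
    exact Finset.card_image_le.trans (by simp))
  refine ⟨(mem_corner_iff s).2 fun i => ?_, heq⟩
  rw [← bary_param_vertex T v hv]
  refine (hpos _ ?_).le
  rw [heq]
  exact Finset.mem_image.2 ⟨i, Finset.mem_univ i, rfl⟩

/-! ### The bump forms -/

/-- The determinant as a continuous alternating form of the rows. -/
def detForm (m : ℕ) : (Fin m → ℝ) [⋀^Fin m]→L[ℝ] ℝ :=
  { (Matrix.detRowAlternating : (Fin m → ℝ) [⋀^Fin m]→ₗ[ℝ] ℝ) with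
    cont := Continuous.matrix_det (A := fun M : Fin m → Fin m → ℝ => Matrix.of M) continuous_id }

/-- The form `dx₁ ∧ ⋯ ∧ dxₘ` on `T`, for the barycentric coordinates of the vertices `v`. -/
def coordWedge (T : Finset V) {m : ℕ} (v : Fin m → V) : Alt T m :=
  (detForm m).compContinuousLinearMap (ContinuousLinearMap.pi fun a => coordL T (v a))

theorem coordWedge_apply (T : Finset V) {m : ℕ} (v : Fin m → V) (u : Fin m → Dir T) :
    coordWedge T v u = (Matrix.of fun a b : Fin m => coordL T (v a) (u b)).det :=
  (Matrix.det_transpose _).symm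

theorem norm_coordWedge_le (T : Finset V) {m : ℕ} (v : Fin m → V) :
    ‖coordWedge T v‖ ≤ ‖detForm m‖ * √2 ^ m := by
  refine (ContinuousAlternatingMap.norm_compContinuousLinearMap_le _ _).trans ?_
  rw [Fintype.card_fin]
  gcongr
  refine ContinuousLinearMap.opNorm_le_bound _ (Real.sqrt_nonneg 2) fun u => ?_
  rw [pi_norm_le_iff_of_nonneg (by positivity)]
  exact fun a => norm_coordL_apply_le T (v a) u

/-- The sum of the `dx_{l₁} ∧ ⋯ ∧ dx_{lₖ}`, `l₁ < ⋯ < lₖ`, for the coordinates of the vertices of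
`σ` other than the first one. -/
def coordWedgeSum (σ : OrderedSimplex K (k + 1)) (T : Finset V) : Alt T k :=
  ∑ j : Fin (k + 1), coordWedge T fun a => σ.vertex (j.succAbove a).succ

theorem norm_coordWedgeSum_le (σ : OrderedSimplex K (k + 1)) (T : Finset V) :
    ‖coordWedgeSum σ T‖ ≤ (k + 1) * (‖detForm k‖ * √2 ^ k) := by
  refine (norm_sum_le_of_le _ fun j _ => norm_coordWedge_le T _).trans ?_
  simp

/-- The bump form of `σ` on `T`, extended to the affine span of `T`. -/
def bumpForm (σ : OrderedSimplex K (k + 1)) (T : Finset V) (x : Dir T) : Alt T k :=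
  bumpFun σ (bary T x) • coordWedgeSum σ T

theorem contDiff_bumpForm (σ : OrderedSimplex K (k + 1)) (T : Finset V) {m : ℕ∞} :
    ContDiff ℝ m (bumpForm σ T) :=
  (contDiff_bumpFun σ T).smul contDiff_const

theorem differentiable_bumpFun (σ : OrderedSimplex K (k + 1)) (T : Finset V) :
    Differentiable ℝ fun x => bumpFun σ (bary T x) :=
  (contDiff_bumpFun σ T (m := 1)).differentiable (by simp)

theorem extDeriv_bumpForm (σ : OrderedSimplex K (k + 1)) (T : Finset V) (x : Dir T) :
    extDeriv (bumpForm σ T) x = ContinuousAlternatingMap.alternatizeUncurryFin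
      ((fderiv ℝ (fun y => bumpFun σ (bary T y)) x).smulRight (coordWedgeSum σ T)) := by
  rw [extDeriv]
  congr 1
  exact ((differentiable_bumpFun σ T x).hasFDerivAt.smul_const (coordWedgeSum σ T)).fderiv

theorem continuous_extDeriv_bumpForm (σ : OrderedSimplex K (k + 1)) (T : Finset V) :
    Continuous (extDeriv (bumpForm σ T)) := by
  have h : Continuous (fderiv ℝ (bumpForm σ T)) :=
    (contDiff_bumpForm σ T (m := 1)).continuous_fderiv (by simp)
  exact (ContinuousAlternatingMap.alternatizeUncurryFinCLM ℝ (Dir T) ℝ).continuous.comp h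

theorem extDeriv_bumpForm_eq_zero (σ : OrderedSimplex K (k + 1)) {T : Finset V} {x : Dir T}
    (h : bumpFun σ (bary T x) = 0) : extDeriv (bumpForm σ T) x = 0 := by
  rw [extDeriv_bumpForm, fderiv_bumpFun_eq_zero σ h]
  ext u
  simp [ContinuousAlternatingMap.alternatizeUncurryFin_apply]

/-- The bump forms and their differentials are bounded uniformly in `σ` and `T`. -/
theorem exists_norm_bumpForm_le (V : Type*) [DecidableEq V] (K : AbstractSimplicialComplex V)
    (k : ℕ) : ∃ B : ℝ, ∀ (σ : OrderedSimplex K (k + 1)) (T : Finset V) (x : Dir T),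
      ‖bumpForm σ T x‖ ≤ B ∧ ‖extDeriv (bumpForm σ T) x‖ ≤ B := by
  obtain ⟨C, hC⟩ := exists_lipschitzWith_bumpFun V K k
  set D : ℝ := (k + 1) * (‖detForm k‖ * √2 ^ k) with hD
  have hD0 : 0 ≤ D := by positivity
  refine ⟨max D ((k + 1) * (C * D)), fun σ T x => ⟨le_max_of_le_left ?_, le_max_of_le_right ?_⟩⟩
  · rw [bumpForm, norm_smul, Real.norm_of_nonneg (bumpFun_nonneg σ _)]
    calc _ ≤ 1 * D := mul_le_mul (bumpFun_le_one σ _) (norm_coordWedgeSum_le σ T) (norm_nonneg _)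
          zero_le_one
      _ = D := one_mul D
  · rw [extDeriv_bumpForm]
    refine (ContinuousAlternatingMap.norm_alternatizeUncurryFin_le _).trans ?_
    rw [ContinuousLinearMap.norm_smulRight_apply]
    gcongr
    · exact norm_fderiv_le_of_lipschitz ℝ (hC σ T)
    · exact norm_coordWedgeSum_le σ T

theorem extDeriv_bumpForm_apply (σ : OrderedSimplex K (k + 1)) (T : Finset V) (x : Dir T)
    (u : Fin (k + 1) → Dir T) :
    extDeriv (bumpForm σ T) x u = ∑ i : Fin (k + 1), (-1) ^ (i : ℕ) *
      (fderiv ℝ (fun y => bumpFun σ (bary T y)) x (u i) *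
        coordWedgeSum σ T fun b => u (i.succAbove b)) := by
  rw [extDeriv_bumpForm, ContinuousAlternatingMap.alternatizeUncurryFin_apply]
  refine Finset.sum_congr rfl fun i _ => ?_
  rw [zsmul_eq_mul]
  push_cast
  rfl

/-- The functions `f₀ = Ψ, f₁ = x_{l₁}, …, fₖ = x_{lₖ}` whose form `f₀ df₁ ∧ ⋯ ∧ dfₖ` is the `j`-th
summand of the bump form. -/
def bumpTuple (σ : OrderedSimplex K (k + 1)) (j : Fin (k + 1)) : Fin (k + 1) → (V → ℝ) → ℝ :=
  Fin.cons (bumpFun σ) fun a t => t (σ.vertex (j.succAbove a).succ)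

theorem isLipschitz_bumpTuple (σ : OrderedSimplex K (k + 1)) (j a : Fin (k + 1)) :
    IsLipschitz K n (bumpTuple σ j a) := by
  refine Fin.cases ?_ (fun b => ?_) a
  · obtain ⟨C, hC⟩ := exists_lipschitzWith_bumpFun V K k
    exact ⟨C, fun T => (hC σ T.1).lipschitzOnWith⟩
  · refine ⟨⟨√2, Real.sqrt_nonneg 2⟩, fun T => LipschitzWith.lipschitzOnWith ?_⟩
    refine LipschitzWith.of_dist_le_mul fun x y => ?_
    rw [Real.dist_eq, dist_eq_norm]
    change |bary T.1 x _ - bary T.1 y _| ≤ _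
    rw [bary_sub_bary]
    exact norm_coordL_apply_le _ _ _

theorem wedge_coord (T : Finset V) {m : ℕ} (v : Fin m → V) (x : Dir T) (u : Fin m → Dir T) :
    wedge T (fun a t => t (v a)) x u = coordWedge T v u := by
  rw [coordWedge_apply, wedge]
  congr 1
  ext a b
  simp only [Matrix.of_apply]
  rw [(hasFDerivAt_bary T (v a) x).fderiv]

theorem wedge_bumpTuple (σ : OrderedSimplex K (k + 1)) (j : Fin (k + 1)) (T : Finset V)
    (x : Dir T) (u : Fin (k + 1) → Dir T) :
    wedge T (bumpTuple σ j) x u = ∑ i : Fin (k + 1), (-1) ^ (i : ℕ) *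
      (fderiv ℝ (fun y => bumpFun σ (bary T y)) x (u i) *
        coordWedge T (fun a => σ.vertex (j.succAbove a).succ) fun b => u (i.succAbove b)) := by
  rw [wedge, Matrix.det_succ_row_zero]
  refine Finset.sum_congr rfl fun i _ => ?_
  rw [← wedge_coord (x := x), wedge, mul_assoc]
  rfl

theorem isSmoothLipschitz_bumpForm (σ : OrderedSimplex K (k + 1))
    (α : ∀ T : TopSimplex K n, Form T.1 k) (β : ∀ T : TopSimplex K n, Form T.1 (k + 1))
    (hα : ∀ T, ∀ x : simplex T.1, α T x = bumpForm σ T.1 x)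
    (hβ : ∀ T, ∀ x : simplex T.1, β T x = extDeriv (bumpForm σ T.1) x) :
    IsSmoothLipschitz K n k α β := by
  refine ⟨fun T => bumpForm σ T.1, fun T => contDiff_bumpForm σ T.1, hα, hβ, Fin (k + 1),
    inferInstance, bumpTuple σ, isLipschitz_bumpTuple σ, fun T =>
    Filter.Eventually.of_forall fun x => ⟨fun u => ?_, fun u => ?_⟩⟩
  · change (bumpFun σ (bary T.1 x) • coordWedgeSum σ T.1) u = _
    rw [ContinuousAlternatingMap.smul_apply, coordWedgeSum, ContinuousAlternatingMap.sum_apply,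
      smul_eq_mul, Finset.mul_sum]
    refine Finset.sum_congr rfl fun j _ => ?_
    rw [← wedge_coord (x := x)]
    rfl
  · rw [extDeriv_bumpForm_apply, Finset.sum_congr rfl fun j _ => wedge_bumpTuple σ j T.1 x u,
      Finset.sum_comm]
    refine Finset.sum_congr rfl fun i _ => ?_
    rw [coordWedgeSum, ContinuousAlternatingMap.sum_apply, Finset.mul_sum, Finset.mul_sum]

/-! ### Locally finite sums in `ℓᵖ` -/

open Classical in
/-- Let every `b j` be bounded by `B`, with at most `N` nonzero entries, and let every entry be
nonzero for at most `M` of the `b j`. Then `∑ a j • b j` converges in `ℓᵖ` when `∑ (a j)ᵖ` does: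
at every entry the `p`-th power of the sum of at most `M` terms is at most `Mᵖ⁻¹` times the sum of
the `p`-th powers. -/
theorem summable_smul_of_bounded_overlap {ι : Type*} {E : ι → Type*}
    [∀ i, NormedAddCommGroup (E i)] [∀ i, NormedSpace ℝ (E i)] [∀ i, CompleteSpace (E i)]
    {p : ℝ≥0∞} [Fact (1 ≤ p)] (hp : p ≠ ∞) (b : ℕ → lp E p) (R : ℕ → ι → Prop) {B : ℝ}
    (hB : ∀ j i, ‖b j i‖ ≤ B) (hR : ∀ j i, ¬ R j i → b j i = 0) {M N : ℕ}
    (hM : ∀ i (t : Finset ℕ), (t.filter (R · i)).card ≤ M)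
    (hN : ∀ j (s : Finset ι), (s.filter (R j)).card ≤ N) (a : ℕ → ℝ) (ha : ∀ j, 0 ≤ a j)
    (hs : Summable fun j => a j ^ p.toReal) : Summable fun j => a j • b j := by
  have hp1 : 1 ≤ p.toReal := by
    simpa using ENNReal.toReal_mono hp (Fact.out : 1 ≤ p)
  have hp0 : 0 < p.toReal := zero_lt_one.trans_le hp1
  by_cases hι : IsEmpty ι
  · have : ∀ j, a j • b j = 0 := fun j => by
      ext i
      exact hι.elim i
    simp only [this, summable_zero]
  obtain ⟨i₀⟩ := not_isEmpty_iff.1 hι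
  have hB0 : 0 ≤ B := (norm_nonneg _).trans (hB 0 i₀)
  set c : ℝ := (M : ℝ) ^ (p.toReal - 1) * B ^ p.toReal with hc
  have hc0 : 0 ≤ c := by positivity
  have hentry : ∀ (t : Finset ℕ) (i : ι), ‖(∑ j ∈ t, a j • b j : lp E p) i‖ ^ p.toReal ≤
      ∑ j ∈ t, if R j i then c * a j ^ p.toReal else 0 := by
    intro t i
    have h1 : (∑ j ∈ t, a j • b j : lp E p) i = ∑ j ∈ t, a j • b j i := by
      rw [lp.coeFn_sum, Finset.sum_apply]
      rfl
    have h2 : ‖(∑ j ∈ t, a j • b j : lp E p) i‖ ≤ ∑ j ∈ t.filter (R · i), a j * B := by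
      rw [h1, Finset.sum_filter]
      refine norm_sum_le_of_le _ fun j _ => ?_
      split_ifs with h
      · rw [norm_smul, Real.norm_of_nonneg (ha j)]
        exact mul_le_mul_of_nonneg_left (hB j i) (ha j)
      · simp [hR j i h]
    calc _ ≤ (∑ j ∈ t.filter (R · i), a j * B) ^ p.toReal :=
          Real.rpow_le_rpow (norm_nonneg _) h2 hp0.le
      _ ≤ ((t.filter (R · i)).card : ℝ) ^ (p.toReal - 1) *
            ∑ j ∈ t.filter (R · i), (a j * B) ^ p.toReal :=
          Real.rpow_sum_le_const_mul_sum_rpow_of_nonneg _ hp1 fun j _ => mul_nonneg (ha j) hB0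
      _ ≤ (M : ℝ) ^ (p.toReal - 1) * ∑ j ∈ t.filter (R · i), (a j * B) ^ p.toReal := by
          refine mul_le_mul_of_nonneg_right (Real.rpow_le_rpow (by positivity) ?_ (by linarith))
            (Finset.sum_nonneg fun j _ => Real.rpow_nonneg (mul_nonneg (ha j) hB0) _)
          exact_mod_cast hM i t
      _ = ∑ j ∈ t, if R j i then c * a j ^ p.toReal else 0 := by
          rw [← Finset.sum_filter, Finset.mul_sum]
          refine Finset.sum_congr rfl fun j _ => ?_
          rw [Real.mul_rpow (ha j) hB0, hc]
          ring
  have hnorm : ∀ t : Finset ℕ, ‖∑ j ∈ t, a j • b j‖ ≤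
      (c * N * ∑ j ∈ t, a j ^ p.toReal) ^ (1 / p.toReal) := by
    intro t
    have h0 : 0 ≤ c * N * ∑ j ∈ t, a j ^ p.toReal :=
      mul_nonneg (by positivity) (Finset.sum_nonneg fun j _ => Real.rpow_nonneg (ha j) _)
    refine lp.norm_le_of_forall_sum_le hp0 (Real.rpow_nonneg h0 _) fun s => ?_
    rw [← Real.rpow_mul h0, one_div_mul_cancel hp0.ne', Real.rpow_one]
    calc _ ≤ ∑ i ∈ s, ∑ j ∈ t, if R j i then c * a j ^ p.toReal else 0 :=
          Finset.sum_le_sum fun i _ => hentry t i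
      _ = ∑ j ∈ t, ((s.filter (R j)).card : ℝ) * (c * a j ^ p.toReal) := by
          rw [Finset.sum_comm]
          refine Finset.sum_congr rfl fun j _ => ?_
          rw [← Finset.sum_filter, Finset.sum_const, nsmul_eq_mul]
      _ ≤ ∑ j ∈ t, (N : ℝ) * (c * a j ^ p.toReal) := by
          refine Finset.sum_le_sum fun j _ => mul_le_mul_of_nonneg_right ?_
            (mul_nonneg hc0 (Real.rpow_nonneg (ha j) _))
          exact_mod_cast hN j s
      _ = _ := by
          rw [Finset.mul_sum]
          exact Finset.sum_congr rfl fun j _ => by ring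
  rw [summable_iff_vanishing_norm]
  intro ε hε
  obtain ⟨s, hs'⟩ := summable_iff_vanishing_norm.1 (hs.mul_left (c * N)) (ε ^ p.toReal)
    (Real.rpow_pos_of_pos hε _)
  refine ⟨s, fun t ht => (hnorm t).trans_lt ?_⟩
  have h0 : 0 ≤ c * N * ∑ j ∈ t, a j ^ p.toReal :=
    mul_nonneg (by positivity) (Finset.sum_nonneg fun j _ => Real.rpow_nonneg (ha j) _)
  have h1 := hs' t ht
  rw [← Finset.mul_sum, Real.norm_of_nonneg h0] at h1
  have h2 := Real.rpow_lt_rpow h0 h1 (one_div_pos.2 hp0)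
  rwa [← Real.rpow_mul hε.le, mul_one_div_cancel hp0.ne', Real.rpow_one] at h2

/-! ### Local finiteness of the complex -/

theorem mem_faces_of_subset {V : Type*} {K : AbstractSimplicialComplex V} {s t : Finset V} (hs : s ∈ K.faces) (hts : t ⊆ s)
    (ht : t.Nonempty) : t ∈ K.faces :=
  (K.isRelLowerSet_faces hs).2 hts ht

open Classical in
/-- The number of simplices of top dimension at a vertex is bounded. -/
theorem exists_card_topSimplex_le (hgeo : BoundedGeometry K) (n : ℕ) :
    ∃ N : ℕ, ∀ (v : V) (s : Finset (TopSimplex K n)), (s.filter fun T => v ∈ T.1).card ≤ N := by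
  obtain ⟨N, hN⟩ := hgeo.starBounded
  refine ⟨2 ^ (N + 1), fun v s => ?_⟩
  set A : Set V := {w : V | w ≠ v ∧ ({v, w} : Finset V) ∈ K.faces} with hA
  have hfin : A.Finite := Set.finite_of_encard_le_coe (hN v)
  have hcard : hfin.toFinset.card ≤ N := by
    have := hN v
    rw [← hA, hfin.encard_eq_coe_toFinset_card] at this
    exact_mod_cast this
  calc _ ≤ (insert v hfin.toFinset).powerset.card := by
        refine Finset.card_le_card_of_injOn (fun T => T.1) (fun T hT => ?_)
          Subtype.val_injective.injOn
        rw [Finset.mem_coe, Finset.mem_filter] at hT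
        rw [Finset.mem_coe, Finset.mem_powerset]
        intro w hw
        rw [Finset.mem_insert, Set.Finite.mem_toFinset]
        refine or_iff_not_imp_left.2 fun hne => ⟨hne, mem_faces_of_subset T.2.1 ?_ (by simp)⟩
        intro x hx
        rw [Finset.mem_insert, Finset.mem_singleton] at hx
        rcases hx with rfl | rfl
        · exact hT.2
        · exact hw
    _ ≤ 2 ^ (N + 1) := by
        rw [Finset.card_powerset]
        exact Nat.pow_le_pow_right (by norm_num)
          ((Finset.card_insert_le _ _).trans (Nat.succ_le_succ hcard))

open Classical in
theorem exists_card_topSimplex_supset_le (hgeo : BoundedGeometry K) (n : ℕ) :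
    ∃ N : ℕ, ∀ (σ : OrderedSimplex K (k + 1)) (s : Finset (TopSimplex K n)),
      (s.filter fun T => σ.face ⊆ T.1).card ≤ N := by
  obtain ⟨N, hN⟩ := exists_card_topSimplex_le hgeo n
  refine ⟨N, fun σ s => (Finset.card_le_card ?_).trans (hN (σ.vertex 0) s)⟩
  exact Finset.monotone_filter_right s fun T _ hT => hT (σ.mem_face 0)

open Classical in
/-- A simplex of dimension `n` has at most `2ⁿ⁺¹` faces. -/
theorem card_filter_face_subset_le {σ : ℕ → OrderedSimplex K (k + 1)}
    (hσ : Function.Injective fun i => (σ i).face) (T : TopSimplex K n) (t : Finset ℕ) :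
    (t.filter fun j => (σ j).face ⊆ T.1).card ≤ 2 ^ (n + 1) := by
  calc _ ≤ T.1.powerset.card := by
        refine Finset.card_le_card_of_injOn (fun j => (σ j).face) (fun j hj => ?_) hσ.injOn
        rw [Finset.mem_coe, Finset.mem_filter] at hj
        exact Finset.mem_coe.2 (Finset.mem_powerset.2 hj.2)
    _ = 2 ^ (n + 1) := by rw [Finset.card_powerset, T.2.2]

theorem finite_topSimplex_supset (hgeo : BoundedGeometry K) (σ : OrderedSimplex K (k + 1)) :
    {T : TopSimplex K n | σ.face ⊆ T.1}.Finite := by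
  classical
  obtain ⟨N, hN⟩ := exists_card_topSimplex_supset_le (k := k) hgeo n
  by_contra h
  obtain ⟨s, hs, hc⟩ := Set.Infinite.exists_subset_card_eq h (N + 1)
  have := hN σ s
  rw [Finset.filter_true_of_mem (p := fun T => σ.face ⊆ T.1) fun T hT => hs hT] at this
  omega

theorem exists_topSimplex_supset (hdim : IsPure K n) {m : ℕ} (σ : OrderedSimplex K m) :
    ∃ T : TopSimplex K n, σ.face ⊆ T.1 := by
  obtain ⟨T, hT, hsub, hcard⟩ := hdim σ.face σ.mem_faces
  exact ⟨⟨T, hT, hcard⟩, hsub⟩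

/-- A complex with finitely many vertices has a compact polyhedron. -/
theorem isCompact_realization [Finite V] : IsCompact (realization K) := by
  have h : realization K = ⋃ s ∈ K.faces,
      {t : V → ℝ | (∀ v, 0 ≤ t v) ∧ (∀ v, v ∉ s → t v = 0) ∧ ∑ v ∈ s, t v = 1} := by
    ext t
    simp only [realization, Set.mem_iUnion, exists_prop]
    rfl
  rw [h]
  refine (Set.toFinite K.faces).isCompact_biUnion fun s _ => ?_
  refine (isCompact_Icc (a := (0 : V → ℝ)) (b := 1)).of_isClosed_subset ?_ ?_
  · simp only [Set.ofPred_and, Set.ofPred_forall]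
    refine (isClosed_iInter fun v => isClosed_le continuous_const (continuous_apply v)).inter
      ((isClosed_iInter fun v => isClosed_iInter fun _ =>
        isClosed_eq (continuous_apply v) continuous_const).inter
        (isClosed_eq (continuous_finsetSum _ fun v _ => continuous_apply v) continuous_const))
  · rintro t ⟨h0, h1, h2⟩
    refine ⟨h0, fun v => ?_⟩
    by_cases hv : v ∈ s
    · exact (Finset.single_le_sum (f := t) (fun i _ => h0 i) hv).trans_eq h2
    · rw [h1 v hv]
      exact zero_le_one

theorem exists_orderedSimplex_face_eq {m : ℕ} {s : Finset V} (hs : s ∈ K.faces)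
    (hcard : s.card = m + 1) : ∃ σ : OrderedSimplex K m, σ.face = s := by
  have himg : (Finset.univ.image fun i => ((s.equivFinOfCardEq hcard).symm i : V)) = s := by
    ext v
    simp only [Finset.mem_image, Finset.mem_univ, true_and]
    constructor
    · rintro ⟨i, rfl⟩
      exact Subtype.prop _
    · intro hv
      exact ⟨s.equivFinOfCardEq hcard ⟨v, hv⟩, by simp⟩
  refine ⟨⟨fun i => (s.equivFinOfCardEq hcard).symm i, ?_, ?_⟩, himg⟩
  · exact Subtype.val_injective.comp (Equiv.injective _)
  · rw [himg]
    exact hs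

/-- In a complex that is not compact there are infinitely many simplices of each dimension up to
the top one, as every vertex is a vertex of one of them. -/
theorem exists_injective_face (hdim : IsPure K n) (hnc : ¬ IsCompact (realization K)) {m : ℕ}
    (hm : m ≤ n) :
    ∃ σ : ℕ → OrderedSimplex K m, Function.Injective fun i => (σ i).face := by
  set A : Set (Finset V) := {s | s ∈ K.faces ∧ s.card = m + 1} with hA
  have hinf : A.Infinite := by
    intro hfin
    have hV : (Set.univ : Set V).Finite := by
      refine (hfin.biUnion fun s _ => s.finite_toSet).subset fun v _ => ?_
      obtain ⟨T, hT, hvT, hcard⟩ := hdim {v} (K.singleton_mem v)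
      obtain ⟨s, hvs, hsT, hs⟩ := Finset.exists_subsuperset_card_eq hvT
        (n := m + 1) (by simp) (by omega)
      refine Set.mem_biUnion (x := s) ⟨mem_faces_of_subset hT hsT ?_, hs⟩ ?_
      · exact Finset.card_pos.1 (by omega)
      · exact hvs (Finset.mem_singleton_self v)
    have : Finite V := Set.finite_univ_iff.1 hV
    exact hnc isCompact_realization
  let f := Set.Infinite.natEmbedding A hinf
  choose σ hσ using fun i => exists_orderedSimplex_face_eq (f i).2.1 (f i).2.2
  refine ⟨σ, fun i j hij => f.injective (Subtype.ext ?_)⟩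
  rw [← hσ i, ← hσ j]
  exact hij

/-! ### Evaluation on a simplex -/

/-- The restriction of the forms in `LpForms` to the simplex `T`. -/
def evalOn (p : ℝ≥0∞) [Fact (1 ≤ p)] (T : TopSimplex K n) : LpForms K n k p →L[ℝ] Form T.1 k :=
  lp.evalCLM ℝ (fun T : TopSimplex K n => Form T.1 k) p T

variable {p q r : ℝ≥0∞} [Fact (1 ≤ p)] [Fact (1 ≤ q)] [Fact (1 ≤ r)]

/-- The restriction of `dω` to the simplex `T`. -/
def dEvalOn (p q : ℝ≥0∞) [Fact (1 ≤ p)] [Fact (1 ≤ q)] (T : TopSimplex K n) :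
    SL K n k p q →L[ℝ] Form T.1 (k + 1) :=
  (evalOn q T).comp ((ContinuousLinearMap.snd ℝ _ _).comp
    ((WithLp.prodContinuousLinearEquiv 1 ℝ (LpForms K n k p)
      (LpForms K n (k + 1) q)).toContinuousLinearMap.comp
      (smoothPairs K n k p q).topologicalClosure.subtypeL))

theorem formOf_d (T : TopSimplex K n) (w : SL K n k p q) :
    formOf (d K n k p q r w) T = dEvalOn p q T w :=
  rfl

/-! ### The bump forms in `SLᵏ` -/

/-- A family of continuous forms that vanish on all but finitely many simplices. -/
def lpOfFinite (p : ℝ≥0∞) (F : ∀ T : TopSimplex K n, Form T.1 k) (hF : {T | F T ≠ 0}.Finite) :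
    LpForms K n k p :=
  ⟨F, (memℓp_zero hF).of_exponent_ge zero_le⟩

/-- The bump form of `σ` on the simplex `T`. -/
def bumpOn (σ : OrderedSimplex K (k + 1)) (T : TopSimplex K n) : Form T.1 k :=
  ⟨fun x => bumpForm σ T.1 x,
    (contDiff_bumpForm σ T.1 (m := 0)).continuous.comp continuous_subtype_val⟩

/-- The differential of the bump form of `σ` on the simplex `T`. -/
def dBumpOn (σ : OrderedSimplex K (k + 1)) (T : TopSimplex K n) : Form T.1 (k + 1) :=
  ⟨fun x => extDeriv (bumpForm σ T.1) x,
    (continuous_extDeriv_bumpForm σ T.1).comp continuous_subtype_val⟩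

theorem bumpOn_eq_zero (σ : OrderedSimplex K (k + 1)) (T : TopSimplex K n) (h : ¬ σ.face ⊆ T.1) :
    bumpOn σ T = 0 := by
  ext1 x
  change bumpFun σ _ • coordWedgeSum σ T.1 = 0
  rw [bumpFun_bary_of_not_subset σ h, zero_smul]

theorem dBumpOn_eq_zero (σ : OrderedSimplex K (k + 1)) (T : TopSimplex K n) (h : ¬ σ.face ⊆ T.1) :
    dBumpOn σ T = 0 := by
  ext1 x
  exact extDeriv_bumpForm_eq_zero σ (bumpFun_bary_of_not_subset σ h x)

/-- The pair `(β, dβ)` for the bump form `β` of `σ`. -/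
def bumpPair (hgeo : BoundedGeometry K) (p q : ℝ≥0∞) (σ : OrderedSimplex K (k + 1)) :
    Pairs K n k p q :=
  WithLp.toLp 1 (lpOfFinite p (bumpOn σ) ((finite_topSimplex_supset hgeo σ).subset fun T hT => by
      by_contra h
      exact hT (bumpOn_eq_zero σ T h)),
    lpOfFinite q (dBumpOn σ) ((finite_topSimplex_supset hgeo σ).subset fun T hT => by
      by_contra h
      exact hT (dBumpOn_eq_zero σ T h)))

/-- The bump form of `σ` as an element of `SLᵏ`. -/
def bumpSL (hgeo : BoundedGeometry K) (p q : ℝ≥0∞) [Fact (1 ≤ p)] [Fact (1 ≤ q)]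
    (σ : OrderedSimplex K (k + 1)) : SL K n k p q :=
  ⟨bumpPair hgeo p q σ, Submodule.le_topologicalClosure _
    (isSmoothLipschitz_bumpForm σ _ _ (fun _ _ => rfl) fun _ _ => rfl)⟩

theorem formOf_bumpSL (hgeo : BoundedGeometry K) (σ : OrderedSimplex K (k + 1))
    (T : TopSimplex K n) : formOf (bumpSL hgeo p q σ) T = bumpOn σ T :=
  rfl

theorem dEvalOn_bumpSL (hgeo : BoundedGeometry K) (σ : OrderedSimplex K (k + 1))
    (T : TopSimplex K n) : dEvalOn p q T (bumpSL hgeo p q σ) = dBumpOn σ T :=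
  rfl

theorem isBumpForm_bumpSL (hgeo : BoundedGeometry K) (σ : OrderedSimplex K (k + 1)) :
    IsBumpForm σ (formOf (bumpSL hgeo p q σ : SL K n k p q)) := by
  intro T x u
  constructor
  · intro h
    have hface : σ.face ⊆ T.1 := (σ.face_subset_iff T.1).2 h
    change (bumpFun σ (bary T.1 x) • coordWedgeSum σ T.1) u = _
    rw [bumpFun_bary σ hface, ← bump_eq_expNegInvGlue (by positivity),
      ContinuousAlternatingMap.smul_apply, smul_eq_mul, coordWedgeSum,
      ContinuousAlternatingMap.sum_apply]
    congr 1
    refine Finset.sum_congr rfl fun j _ => ?_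
    rw [coordWedge_apply]
    congr 1
    ext a b
    exact coordL_of_mem (h _) (u b)
  · intro h
    rw [formOf_bumpSL, bumpOn_eq_zero σ T fun hface => h ((σ.face_subset_iff T.1).1 hface)]
    rfl

/-- The sum of the bump forms with the coefficients `a` converges in `SLᵏ` when `∑ (a i)ᵖ` does. -/
theorem summable_smul_bumpSL (hgeo : BoundedGeometry K) (hp : p ≠ ∞)
    {σ : ℕ → OrderedSimplex K (k + 1)} (hσ : Function.Injective fun i => (σ i).face) (a : ℕ → ℝ)
    (ha : ∀ i, 0 ≤ a i) (hs : Summable fun i => a i ^ p.toReal) :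
    Summable fun i => a i • (bumpSL hgeo p p (σ i) : SL K n k p p) := by
  classical
  obtain ⟨B, hB⟩ := exists_norm_bumpForm_le V K k
  obtain ⟨N, hN⟩ := exists_card_topSimplex_supset_le (k := k) hgeo n
  have hB0 : 0 ≤ B := by
    obtain ⟨v⟩ := hgeo.nonempty
    exact (norm_nonneg _).trans (hB (σ 0) ∅ 0).1
  have h1 : Summable fun i => a i • (bumpSL hgeo p p (σ i) : SL K n k p p).1.fst :=
    summable_smul_of_bounded_overlap (E := fun T : TopSimplex K n => Form T.1 k) hp
      (fun i => (bumpSL hgeo p p (σ i) : SL K n k p p).1.fst) (fun i T => (σ i).face ⊆ T.1)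
      (fun i T => (ContinuousMap.norm_le _ hB0).2 fun x => (hB (σ i) T.1 x).1)
      (fun i T h => bumpOn_eq_zero (σ i) T h) (M := 2 ^ (n + 1)) (N := N)
      (fun T t => by convert card_filter_face_subset_le hσ T t)
      (fun i s => by convert hN (σ i) s) a ha hs
  have h2 : Summable fun i => a i • (bumpSL hgeo p p (σ i) : SL K n k p p).1.snd :=
    summable_smul_of_bounded_overlap (E := fun T : TopSimplex K n => Form T.1 (k + 1)) hp
      (fun i => (bumpSL hgeo p p (σ i) : SL K n k p p).1.snd) (fun i T => (σ i).face ⊆ T.1)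
      (fun i T => (ContinuousMap.norm_le _ hB0).2 fun x => (hB (σ i) T.1 x).2)
      (fun i T h => dBumpOn_eq_zero (σ i) T h) (M := 2 ^ (n + 1)) (N := N)
      (fun T t => by convert card_filter_face_subset_le hσ T t)
      (fun i s => by convert hN (σ i) s) a ha hs
  have h3 : HasSum (fun i => a i • (bumpSL hgeo p p (σ i) : SL K n k p p).1)
      (WithLp.toLp 1 (∑' i, a i • (bumpSL hgeo p p (σ i) : SL K n k p p).1.fst,
        ∑' i, a i • (bumpSL hgeo p p (σ i) : SL K n k p p).1.snd)) :=
    (h1.hasSum.prodMk h2.hasSum).mapL (WithLp.prodContinuousLinearEquiv 1 ℝ (LpForms K n k p)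
      (LpForms K n (k + 1) p)).symm.toContinuousLinearMap
  have hmem := (smoothPairs K n k p p).isClosed_topologicalClosure.mem_of_tendsto h3
    (Filter.Eventually.of_forall fun s => Submodule.sum_mem _ fun i _ =>
      Submodule.smul_mem _ (a i) (bumpSL hgeo p p (σ i) : SL K n k p p).2)
  refine ⟨⟨_, hmem⟩, ?_⟩
  exact (Topology.IsInducing.subtypeVal.hasSum_iff
    (g := (smoothPairs K n k p p).topologicalClosure.subtype) _ _).1 h3

/-! ### Weighted integrals over faces -/

open MeasureTheory

instance isFiniteMeasure_corner (m : ℕ) :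
    IsFiniteMeasure (Measure.comap (Subtype.val : corner m → Fin m → ℝ) volume) := by
  refine ⟨?_⟩
  rw [Measure.comap_apply _ Subtype.val_injective
    (fun t ht => (isCompact_corner m).measurableSet.subtype_image ht) _ MeasurableSet.univ]
  simpa using (isCompact_corner m).measure_lt_top

theorem integrable_of_continuous_corner {m : ℕ} {f : corner m → ℝ} (hf : Continuous f) :
    Integrable f (Measure.comap Subtype.val volume) :=
  hf.integrable_of_hasCompactSupport (HasCompactSupport.of_compactSpace _)

theorem integral_corner_eq_integral {m : ℕ} (f : (Fin m → ℝ) → ℝ) (hf : ∀ s ∉ corner m, f s = 0) :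
    ∫ s : corner m, f s ∂(Measure.comap Subtype.val volume) = ∫ s, f s := by
  rw [integral_subtype_comap (isCompact_corner m).measurableSet f,
    setIntegral_eq_integral_of_forall_compl_eq_zero hf]

/-- The edges `vⱼ - v₀` of the face of `T` with the vertices `v`. -/
def edge (T : Finset V) {m : ℕ} (v : Fin (m + 1) → T) (j : Fin m) : Dir T :=
  vtx T (v j.succ) - vtx T (v 0)

theorem norm_vtx_sub_le (T : Finset V) (a b : T) : ‖vtx T a - vtx T b‖ ≤ 1 := by
  have h := sum_sq_bary_sub T (vtx T a) (vtx T b)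
  have h1 : ∑ v ∈ T, (bary T (vtx T a) v - bary T (vtx T b) v) ^ 2 ≤
      ∑ v ∈ T, ((if v = a then (1 : ℝ) else 0) + if v = b then (1 : ℝ) else 0) := by
    refine Finset.sum_le_sum fun v _ => ?_
    rw [bary_vtx, bary_vtx]
    split_ifs <;> norm_num
  rw [Finset.sum_add_distrib, Finset.sum_ite_eq', Finset.sum_ite_eq', if_pos a.2, if_pos b.2] at h1
  have h2 : ‖vtx T a - vtx T b‖ ^ 2 ≤ 1 := by linarith
  exact (sq_le_one_iff₀ (norm_nonneg _)).1 h2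

theorem norm_apply_edge_le (T : Finset V) {m j : ℕ} (v : Fin (m + 1) → T) (φ : Alt T j)
    (f : Fin j → Fin m) : ‖φ fun b => edge T v (f b)‖ ≤ ‖φ‖ := by
  refine (φ.le_opNorm _).trans (mul_le_of_le_one_right (norm_nonneg _) ?_)
  exact Finset.prod_le_one (fun _ _ => norm_nonneg _) fun _ _ => norm_vtx_sub_le T _ _

/-- The integral `∫ χ φ` over the face of `T` with the vertices `v`, where the weight `χ` is a
function of the affine coordinates of the face. -/
def weightedIntegral (T : Finset V) {m : ℕ} (v : Fin (m + 1) → T) (χ : C(Fin m → ℝ, ℝ)) :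
    Form T m →L[ℝ] ℝ :=
  LinearMap.mkContinuous
    { toFun := fun φ : Form T m => ∫ s : corner m, χ s * φ ⟨param T v s, param_mem T v s.2⟩ (edge T v)
        ∂(Measure.comap Subtype.val volume)
      map_add' := fun φ ψ => by
        rw [← integral_add]
        · simp [mul_add]
        · exact integrable_of_continuous_corner
            ((χ.continuous.comp continuous_subtype_val).mul (continuous_integrand T v φ))
        · exact integrable_of_continuous_corner
            ((χ.continuous.comp continuous_subtype_val).mul (continuous_integrand T v ψ))
      map_smul' := fun c φ => by
        rw [RingHom.id_apply, smul_eq_mul, ← integral_const_mul]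
        refine integral_congr_ae (Filter.Eventually.of_forall fun s => ?_)
        simp
        ring }
    (∫ s : corner m, |χ s| ∂(Measure.comap Subtype.val volume)) fun φ => by
      change ‖∫ s : corner m, _ ∂_‖ ≤ _
      rw [← integral_mul_const]
      refine norm_integral_le_of_norm_le (integrable_of_continuous_corner
        ((χ.continuous.comp continuous_subtype_val).abs.mul continuous_const))
        (Filter.Eventually.of_forall fun s => ?_)
      rw [norm_mul, Real.norm_eq_abs]
      gcongr
      exact (norm_apply_edge_le T v _ id).trans (φ.norm_coe_le_norm _)

theorem weightedIntegral_apply (T : Finset V) {m : ℕ} (v : Fin (m + 1) → T) (χ : C(Fin m → ℝ, ℝ))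
    (φ : Form T m) : weightedIntegral T v χ φ =
      ∫ s : corner m, χ s * φ ⟨param T v s, param_mem T v s.2⟩ (edge T v)
        ∂(Measure.comap Subtype.val volume) :=
  rfl

theorem faceIntegral_eq_weightedIntegral (T : Finset V) {m : ℕ} (v : Fin (m + 1) → T)
    (φ : Form T m) : faceIntegral T v φ = weightedIntegral T v 1 φ := by
  rw [weightedIntegral_apply]
  simp only [ContinuousMap.one_apply, one_mul]
  rfl

/-! ### Stokes' theorem with compact supports -/

/-- The linear part of the parametrization of a face. -/
def paramL (T : Finset V) {m : ℕ} (v : Fin (m + 1) → T) : (Fin m → ℝ) →L[ℝ] Dir T :=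
  ∑ j, (ContinuousLinearMap.proj (R := ℝ) (φ := fun _ : Fin m => ℝ) j).smulRight (edge T v j)

theorem paramL_single (T : Finset V) {m : ℕ} (v : Fin (m + 1) → T) (i : Fin m) :
    paramL T v (Pi.single i 1) = edge T v i := by
  simp [paramL, Pi.single_apply, ite_smul]

theorem hasFDerivAt_param (T : Finset V) {m : ℕ} (v : Fin (m + 1) → T) (s : Fin m → ℝ) :
    HasFDerivAt (param T v) (paramL T v) s := by
  have h : param T v = fun s => vtx T (v 0) + paramL T v s := by
    funext s
    simp only [param, paramL, edge, sum_apply,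
      ContinuousLinearMap.smulRight_apply, ContinuousLinearMap.proj_apply, smul_sub,
      Finset.sum_sub_distrib, sub_smul, one_smul, Finset.sum_smul]
    abel
  rw [h]
  exact (paramL T v).hasFDerivAt.const_add _

theorem contDiff_param (T : Finset V) {m : ℕ} (v : Fin (m + 1) → T) {r : WithTop ℕ∞} :
    ContDiff ℝ r (param T v) := by
  unfold param
  fun_prop

theorem integral_mul_fderiv_of_hasCompactSupport {m : ℕ} {f g : (Fin m → ℝ) → ℝ}
    (hf : ContDiff ℝ 1 f) (hg : ContDiff ℝ 1 g) (h : HasCompactSupport f ∨ HasCompactSupport g)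
    (v : Fin m → ℝ) : ∫ x, f x * fderiv ℝ g x v = -∫ x, fderiv ℝ f x v * g x := by
  have hf' : Continuous fun x => fderiv ℝ f x v :=
    (hf.continuous_fderiv (by simp)).clm_apply continuous_const
  have hg' : Continuous fun x => fderiv ℝ g x v :=
    (hg.continuous_fderiv (by simp)).clm_apply continuous_const
  have hcs : ∀ {φ ψ : (Fin m → ℝ) → ℝ}, Continuous φ → Continuous ψ →
      HasCompactSupport φ ∨ HasCompactSupport ψ → Integrable fun x => φ x * ψ x := by
    intro φ ψ hφ hψ h
    refine (hφ.mul hψ).integrable_of_hasCompactSupport ?_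
    rcases h with h | h
    · exact h.mul_right
    · exact h.mul_left
  exact integral_mul_fderiv_eq_neg_fderiv_mul_of_integrable
    (hcs hf' hg.continuous (h.imp_left fun h => h.fderiv_apply ℝ v))
    (hcs hf.continuous hg' (h.imp_right fun h => h.fderiv_apply ℝ v))
    (hcs hf.continuous hg.continuous h)
    (fun x _ => hf.differentiable (by simp) x) fun x _ => hg.differentiable (by simp) x

/-- Stokes' theorem on the affine span of a face for the form `χ F`, if `χ` or the restriction of
`F` has compact support: `∫ χ dF = -∫ dχ ∧ F`. -/
theorem integral_mul_extDeriv_param (T : Finset V) {m : ℕ} (v : Fin (m + 1 + 1) → T)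
    {F : Dir T → Alt T m} (hF : ContDiff ℝ 1 F) {χ : (Fin (m + 1) → ℝ) → ℝ} (hχ : ContDiff ℝ 1 χ)
    (h : HasCompactSupport χ ∨ HasCompactSupport fun s => F (param T v s)) :
    ∫ s, χ s * extDeriv F (param T v s) (edge T v) =
      -∑ i : Fin (m + 1), (-1) ^ (i : ℕ) * ∫ s, fderiv ℝ χ s (Pi.single i 1) *
        F (param T v s) fun b => edge T v (i.succAbove b) := by
  set g : Fin (m + 1) → (Fin (m + 1) → ℝ) → ℝ := fun i s =>
    F (param T v s) fun b => edge T v (i.succAbove b) with hg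
  have hgC : ∀ i, ContDiff ℝ 1 (g i) := fun i =>
    (ContinuousAlternatingMap.apply ℝ (Dir T) ℝ fun b => edge T v (i.succAbove b)).contDiff.comp
      (hF.comp (contDiff_param T v))
  have hgs : ∀ i, HasCompactSupport χ ∨ HasCompactSupport (g i) := fun i =>
    h.imp_right fun h => h.comp_left (g := fun φ : Alt T m => φ fun b => edge T v (i.succAbove b))
      rfl
  have hd : ∀ s, extDeriv F (param T v s) (edge T v) =
      ∑ i : Fin (m + 1), (-1) ^ (i : ℕ) * fderiv ℝ (g i) s (Pi.single i 1) := by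
    intro s
    have hFd := hF.differentiable (by simp) (param T v s)
    rw [extDeriv_apply hFd]
    refine Finset.sum_congr rfl fun i _ => ?_
    have h1 : HasFDerivAt (fun x => F x fun b => edge T v (i.succAbove b))
        (fderiv ℝ (fun x => F x (i.removeNth (edge T v))) (param T v s)) (param T v s) :=
      (((ContinuousAlternatingMap.apply ℝ (Dir T) ℝ
        fun b => edge T v (i.succAbove b)).differentiableAt).comp _ hFd).hasFDerivAt
    have h2 := (h1.comp s (hasFDerivAt_param T v s)).fderiv
    have h3 : fderiv ℝ (g i) s = _ := h2
    rw [h3, ContinuousLinearMap.comp_apply, paramL_single, zsmul_eq_mul]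
    push_cast
    rfl
  have hint : ∀ i : Fin (m + 1), Integrable fun s =>
      χ s * ((-1) ^ (i : ℕ) * fderiv ℝ (g i) s (Pi.single i 1)) := by
    intro i
    have hc : Continuous fun s => fderiv ℝ (g i) s (Pi.single i 1) :=
      ((hgC i).continuous_fderiv (by simp)).clm_apply continuous_const
    refine (hχ.continuous.mul (continuous_const.mul hc)).integrable_of_hasCompactSupport ?_
    rcases hgs i with h | h
    · exact h.mul_right
    · exact ((h.fderiv_apply ℝ _).mul_left).mul_left
  simp only [hd, Finset.mul_sum]
  rw [integral_finsetSum _ fun i _ => hint i, ← Finset.sum_neg_distrib]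
  refine Finset.sum_congr rfl fun i _ => ?_
  rw [← mul_neg, ← integral_mul_fderiv_of_hasCompactSupport hχ (hgC i) (hgs i),
    ← integral_const_mul]
  exact integral_congr_ae (Filter.Eventually.of_forall fun s => by ring)

theorem weightedIntegral_extDeriv_eq (T : Finset V) {m : ℕ} (v : Fin (m + 1 + 1) → T)
    (χ : C(Fin (m + 1) → ℝ, ℝ)) {F : Dir T → Alt T m} (φ : Form T (m + 1))
    (hφ : ∀ x : simplex T, φ x = extDeriv F x)
    (h : ∀ s ∉ corner (m + 1), χ s * extDeriv F (param T v s) (edge T v) = 0) :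
    weightedIntegral T v χ φ = ∫ s, χ s * extDeriv F (param T v s) (edge T v) := by
  rw [weightedIntegral_apply, ← integral_corner_eq_integral _ h]
  simp only [hφ]

/-- For a weight `χ` supported in the simplex, the integral of `χ dω` over a face is bounded by the
supremum of `|ω|`, uniformly in the face: `∫ χ dω = -∫ dχ ∧ ω`, first for smooth `ω` and then, by
continuity, for all `ω` in `SLᵏ`. -/
theorem exists_abs_weightedIntegral_dEvalOn_le (χ : C(Fin (k + 1) → ℝ, ℝ)) (hχ : ContDiff ℝ 1 χ)
    (hsupp : ∀ s ∉ corner (k + 1), χ s = 0) :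
    ∃ C : ℝ, 0 ≤ C ∧ ∀ (T : TopSimplex K n) (v : Fin (k + 1 + 1) → T.1) (w : SL K n k p q),
      |weightedIntegral T.1 v χ (dEvalOn p q T w)| ≤ C * ‖formOf w T‖ := by
  have htsupp : tsupport χ ⊆ corner (k + 1) :=
    closure_minimal (fun s hs => by_contra fun h => hs (hsupp s h)) (isCompact_corner _).isClosed
  have hcs : HasCompactSupport χ :=
    (isCompact_corner (k + 1)).of_isClosed_subset (isClosed_tsupport _) htsupp
  have hdχ : ∀ s ∉ corner (k + 1), fderiv ℝ χ s = 0 := fun s hs => by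
    by_contra h
    exact hs (htsupp (support_fderiv_subset ℝ h))
  have hdint : ∀ i : Fin (k + 1), Integrable fun s => |fderiv ℝ χ s (Pi.single i 1)| := fun i =>
    ((hχ.continuous_fderiv (by simp)).clm_apply
      continuous_const).integrable_of_hasCompactSupport (hcs.fderiv_apply ℝ _) |>.abs
  refine ⟨∑ i : Fin (k + 1), ∫ s, |fderiv ℝ χ s (Pi.single i 1)|,
    Finset.sum_nonneg fun i _ => integral_nonneg fun s => abs_nonneg _, fun T v w => ?_⟩
  have hclosed : IsClosed {z : Pairs K n k p q | |weightedIntegral T.1 v χ (z.snd.on T)| ≤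
      (∑ i : Fin (k + 1), ∫ s, |fderiv ℝ χ s (Pi.single i 1)|) * ‖z.fst.on T‖} := by
    have hE := (WithLp.prodContinuousLinearEquiv 1 ℝ (LpForms K n k p)
      (LpForms K n (k + 1) q)).continuous
    have hfst : Continuous fun z : Pairs K n k p q => ‖z.fst.on T‖ :=
      (continuous_norm (E := Form T.1 k)).comp
        ((evalOn p T).continuous.comp (continuous_fst.comp hE))
    refine isClosed_le ?_ (continuous_const.mul hfst)
    exact ((weightedIntegral T.1 v χ).continuous.comp
      ((evalOn q T).continuous.comp (continuous_snd.comp hE))).abs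
  refine closure_minimal (s := (smoothPairs K n k p q : Set (Pairs K n k p q))) ?_ hclosed w.2
  rintro z ⟨F, hF, hα, hβ, -⟩
  change |weightedIntegral T.1 v χ (z.snd.on T)| ≤ _
  rw [weightedIntegral_extDeriv_eq T.1 v χ (z.snd.on T) (hβ T)
    (fun s hs => by rw [hsupp s hs, zero_mul]),
    integral_mul_extDeriv_param T.1 v ((hF T).of_le (by exact_mod_cast le_top)) hχ (Or.inl hcs),
    abs_neg, Finset.sum_mul]
  refine (Finset.abs_sum_le_sum_abs _ _).trans (Finset.sum_le_sum fun i _ => ?_)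
  rw [abs_mul, abs_pow, abs_neg, abs_one, one_pow, one_mul, ← integral_mul_const]
  refine (Real.norm_eq_abs _).symm.trans_le (norm_integral_le_of_norm_le
    ((hdint i).mul_const _) (Filter.Eventually.of_forall fun s => ?_))
  rw [norm_mul, Real.norm_eq_abs]
  by_cases hs : s ∈ corner (k + 1)
  · refine mul_le_mul_of_nonneg_left ?_ (abs_nonneg _)
    rw [← hα T ⟨param T.1 v s, param_mem T.1 v hs⟩]
    exact (norm_apply_edge_le T.1 v _ i.succAbove).trans ((z.fst.on T).norm_coe_le_norm _)
  · simp [hdχ s hs]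

/-! ### Integrals of bump forms -/

theorem weightedIntegral_dBumpOn (σ : OrderedSimplex K (k + 1)) (T : TopSimplex K n)
    (v : Fin (k + 1 + 1) → T.1) (hv : Function.Injective v) (χ : C(Fin (k + 1) → ℝ, ℝ)) :
    weightedIntegral T.1 v χ (dBumpOn σ T) =
      ∫ s, χ s * extDeriv (bumpForm σ T.1) (param T.1 v s) (edge T.1 v) := by
  refine weightedIntegral_extDeriv_eq T.1 v χ (dBumpOn σ T) (fun _ => rfl) fun s hs => ?_
  rw [extDeriv_bumpForm_eq_zero σ (by_contra fun h => hs (bumpFun_param_ne_zero σ T.1 v hv s h).1)]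
  simp

/-- The integral of `dβ` over any simplex vanishes, by Stokes' theorem: the restriction of the bump
form `β` to the affine span of the simplex is supported in the simplex. -/
theorem weightedIntegral_one_dBumpOn (σ : OrderedSimplex K (k + 1)) (T : TopSimplex K n)
    (v : Fin (k + 1 + 1) → T.1) (hv : Function.Injective v) :
    weightedIntegral T.1 v 1 (dBumpOn σ T) = 0 := by
  have hcs : HasCompactSupport fun s => bumpForm σ T.1 (param T.1 v s) := by
    refine HasCompactSupport.of_support_subset_isCompact (isCompact_corner (k + 1)) fun s hs => ?_
    refine (bumpFun_param_ne_zero σ T.1 v hv s fun h => hs ?_).1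
    change bumpFun σ _ • _ = (0 : Alt T.1 k)
    rw [h, zero_smul]
  rw [weightedIntegral_dBumpOn σ T v hv,
    integral_mul_extDeriv_param T.1 v (contDiff_bumpForm σ T.1 (m := 1))
      (χ := (1 : C(Fin (k + 1) → ℝ, ℝ))) contDiff_const (Or.inr hcs), neg_eq_zero]
  refine Finset.sum_eq_zero fun i _ => ?_
  simp

theorem weightedIntegral_dBumpOn_of_ne (σ : OrderedSimplex K (k + 1)) (T : TopSimplex K n)
    (v : Fin (k + 1 + 1) → T.1) (hv : Function.Injective v) (χ : C(Fin (k + 1) → ℝ, ℝ))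
    (hne : σ.face ≠ Finset.univ.image fun i => (v i : V)) :
    weightedIntegral T.1 v χ (dBumpOn σ T) = 0 := by
  have h : ∀ s, extDeriv (bumpForm σ T.1) (param T.1 v s) = 0 := fun s =>
    extDeriv_bumpForm_eq_zero σ (by_contra fun h => hne (bumpFun_param_ne_zero σ T.1 v hv s h).2)
  rw [weightedIntegral_dBumpOn σ T v hv]
  simp [h]

/-- The restriction of the bump function of `σ` to `σ`, in affine coordinates. It depends on the
dimension only. -/
def cornerBump (k : ℕ) (s : Fin (k + 1) → ℝ) : ℝ :=
  expNegInvGlue (1 - 2 * (k + 2 : ℝ) ^ 2 * ∑ i, (cornerBary s i - 1 / (k + 2)) ^ 2)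

theorem contDiff_cornerBump (k : ℕ) {m : ℕ∞} : ContDiff ℝ m (cornerBump k) := by
  refine expNegInvGlue.contDiff.comp (contDiff_const.sub (contDiff_const.mul
    (ContDiff.sum fun i _ => (ContDiff.sub ?_ contDiff_const).pow 2)))
  refine Fin.cases ?_ (fun j => ?_) i
  · simp only [cornerBary, Fin.cons_zero]
    fun_prop
  · simp only [cornerBary, Fin.cons_succ]
    fun_prop

theorem cornerBump_eq_zero {s : Fin (k + 1) → ℝ} (hs : s ∉ corner (k + 1)) :
    cornerBump k s = 0 := by
  rw [mem_corner_iff, not_forall] at hs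
  obtain ⟨i, hi⟩ := hs
  exact expNegInvGlue_eq_zero_of_nonpos k (not_le.1 hi).le (Finset.single_le_sum
    (f := fun i => (cornerBary s i - 1 / (k + 2 : ℝ)) ^ 2) (fun i _ => sq_nonneg _)
    (Finset.mem_univ i))

theorem bumpFun_param (σ : OrderedSimplex K (k + 1)) (T : Finset V) (h : ∀ i, σ.vertex i ∈ T)
    (s : Fin (k + 1) → ℝ) :
    bumpFun σ (bary T (param T (fun i => ⟨σ.vertex i, h i⟩) s)) = cornerBump k s := by
  have h0 : ∀ v ∉ σ.face, bary T (param T (fun i => ⟨σ.vertex i, h i⟩) s) v = 0 := fun v hv =>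
    bary_param_of_forall_ne _ _ _ _ fun i hi => hv (hi ▸ σ.mem_face i)
  have hinj : Function.Injective fun i => (⟨σ.vertex i, h i⟩ : T) := fun i j hij =>
    σ.injective (Subtype.ext_iff.1 hij)
  rw [bumpFun, cornerBump, tsum_sq_sub_centerBary σ σ.face _ h0, Finset.union_self,
    OrderedSimplex.face, Finset.sum_image σ.injective.injOn]
  congr 3
  refine Finset.sum_congr rfl fun i _ => ?_
  rw [centerBary, if_pos (σ.mem_face i), ← bary_param_vertex T _ hinj s i]

/-- The direction `(1, -1, 1, …)`, in which `dβ` differentiates the bump function. -/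
def altDir (k : ℕ) (i : Fin (k + 1)) : ℝ := (-1) ^ (i : ℕ)

/-- The coefficient `∑ᵢ (-1)ⁱ ∂ᵢΨ` of `dβ` on the simplex `σ` itself, used as the weight that
detects `dβ`. -/
def bumpWeight (k : ℕ) : C(Fin (k + 1) → ℝ, ℝ) :=
  ⟨fun s => fderiv ℝ (cornerBump k) s (altDir k),
    ((contDiff_cornerBump k (m := 1)).continuous_fderiv (by simp)).clm_apply continuous_const⟩

theorem contDiff_bumpWeight (k : ℕ) : ContDiff ℝ 1 (bumpWeight k) :=
  ((contDiff_cornerBump k (m := 2)).fderiv_right (m := 1) (by norm_num)).clm_apply contDiff_const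

theorem bumpWeight_eq_zero {s : Fin (k + 1) → ℝ} (hs : s ∉ corner (k + 1)) :
    bumpWeight k s = 0 := by
  have h : fderiv ℝ (cornerBump k) s = 0 :=
    IsLocalMin.fderiv_eq_zero (Filter.Eventually.of_forall fun y => by
      rw [cornerBump_eq_zero hs]
      exact expNegInvGlue.nonneg _)
  change fderiv ℝ (cornerBump k) s _ = 0
  rw [h]
  rfl

/-- A compactly supported function that is constant in one direction vanishes, so the weight is not
identically zero. -/
theorem integral_sq_bumpWeight_pos (k : ℕ) : 0 < ∫ s, bumpWeight k s * bumpWeight k s := by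
  have hne : ∃ s, bumpWeight k s ≠ 0 := by
    by_contra! hzero
    let c : ℝ → Fin (k + 1) → ℝ := fun t => (fun _ => 1 / (k + 2 : ℝ)) + t • altDir k
    have hc : ∀ t, HasDerivAt c (altDir k) t := fun t => by
      have h := ((hasDerivAt_id t).smul_const (altDir k)).const_add fun _ => 1 / (k + 2 : ℝ)
      rw [one_smul] at h
      exact h
    have hd : ∀ t, HasDerivAt (fun t => cornerBump k (c t)) 0 t := fun t => by
      have h := ((contDiff_cornerBump k (m := 1)).differentiable (by simp)
        (c t)).hasFDerivAt.comp_hasDerivAt t (hc t)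
      have h0 : fderiv ℝ (cornerBump k) (c t) (altDir k) = 0 := hzero (c t)
      rwa [h0] at h
    have hconst := is_const_of_deriv_eq_zero (fun t => (hd t).differentiableAt)
      (fun t => (hd t).deriv) 0 2
    have hk : (0 : ℝ) < k + 2 := by positivity
    have h2 : cornerBump k (c 2) = 0 := by
      refine cornerBump_eq_zero fun hmem => ?_
      have h3 := (mem_corner_iff _).1 hmem
      have h4 := Finset.single_le_sum (fun i _ => h3 i) (Finset.mem_univ (Fin.succ 0))
      rw [sum_cornerBary] at h4
      have h5 : cornerBary (c 2) (Fin.succ 0) = 1 / (k + 2 : ℝ) + 2 := by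
        simp [cornerBary, c, altDir]
      have h6 : 0 < 1 / (k + 2 : ℝ) := by positivity
      linarith
    have h0 : ∀ i, cornerBary (c 0) i = 1 / (k + 2 : ℝ) := by
      refine Fin.cases ?_ fun j => ?_
      · simp only [cornerBary, c, zero_smul, add_zero, Fin.cons_zero, Finset.sum_const,
          Finset.card_univ, Fintype.card_fin, nsmul_eq_mul]
        push_cast
        field_simp
        ring
      · simp [cornerBary, c]
    have h1 : 0 < cornerBump k (c 0) := expNegInvGlue.pos_of_pos (by simp [h0])
    rw [h2] at hconst
    exact h1.ne' hconst
  obtain ⟨s, hs⟩ := hne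
  refine ((bumpWeight k).continuous.mul
    (bumpWeight k).continuous).integral_pos_of_hasCompactSupport_nonneg_nonzero ?_
    (fun s => mul_self_nonneg _) (mul_self_ne_zero.2 hs)
  refine HasCompactSupport.of_support_subset_isCompact (isCompact_corner (k + 1)) fun s hs => ?_
  by_contra h
  exact hs (by simp [bumpWeight_eq_zero h])

theorem coordWedgeSum_edge (σ : OrderedSimplex K (k + 1)) (T : Finset V)
    (h : ∀ i, σ.vertex i ∈ T) (i : Fin (k + 1)) :
    (coordWedgeSum σ T fun b => edge T (fun i => ⟨σ.vertex i, h i⟩) (i.succAbove b)) = 1 := by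
  have hentry : ∀ l b : Fin (k + 1), coordL T (σ.vertex l.succ)
      (edge T (fun i => ⟨σ.vertex i, h i⟩) b) = if l = b then 1 else 0 := by
    intro l b
    rw [edge, coordL_vtx_sub]
    simp [σ.injective.eq_iff]
  rw [coordWedgeSum, ContinuousAlternatingMap.sum_apply, Finset.sum_eq_single i]
  · rw [coordWedge_apply]
    simp only [hentry, Fin.succAbove_right_inj]
    exact Matrix.det_one
  · intro j _ hj
    -- The coordinate of the omitted edge vanishes on the remaining ones.
    obtain ⟨a, ha⟩ := Fin.exists_succAbove_eq hj.symm
    rw [coordWedge_apply]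
    refine Matrix.det_eq_zero_of_row_eq_zero a fun b => ?_
    rw [Matrix.of_apply, ha, hentry, if_neg (Fin.succAbove_ne i b).symm]
  · simp

theorem extDeriv_bumpForm_edge (σ : OrderedSimplex K (k + 1)) (T : Finset V)
    (h : ∀ i, σ.vertex i ∈ T) (s : Fin (k + 1) → ℝ) :
    extDeriv (bumpForm σ T) (param T (fun i => ⟨σ.vertex i, h i⟩) s)
      (edge T fun i => ⟨σ.vertex i, h i⟩) = bumpWeight k s := by
  have hd : fderiv ℝ (cornerBump k) s = (fderiv ℝ (fun x => bumpFun σ (bary T x))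
      (param T (fun i => ⟨σ.vertex i, h i⟩) s)).comp (paramL T fun i => ⟨σ.vertex i, h i⟩) := by
    have h1 := ((differentiable_bumpFun σ T _).hasFDerivAt.comp s
      (hasFDerivAt_param T (fun i => ⟨σ.vertex i, h i⟩) s)).fderiv
    rw [← h1]
    congr 1
    exact funext fun s => (bumpFun_param σ T h s).symm
  have halt : altDir k = ∑ i : Fin (k + 1), (-1 : ℝ) ^ (i : ℕ) • Pi.single i (1 : ℝ) := by
    ext j
    simp [altDir, Finset.sum_apply, Pi.single_apply]
  change _ = fderiv ℝ (cornerBump k) s (altDir k)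
  rw [extDeriv_bumpForm_apply, halt, map_sum]
  refine Finset.sum_congr rfl fun i _ => ?_
  rw [coordWedgeSum_edge, mul_one, map_smul, hd, ContinuousLinearMap.comp_apply, paramL_single,
    smul_eq_mul]

theorem weightedIntegral_bumpWeight_dBumpOn (σ : OrderedSimplex K (k + 1)) (T : TopSimplex K n)
    (h : ∀ i, σ.vertex i ∈ T.1) :
    weightedIntegral T.1 (fun i => ⟨σ.vertex i, h i⟩) (bumpWeight k) (dBumpOn σ T) =
      ∫ s, bumpWeight k s * bumpWeight k s := by
  rw [weightedIntegral_dBumpOn σ T _ fun i j hij => σ.injective (Subtype.ext_iff.1 hij)]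
  simp only [extDeriv_bumpForm_edge]

/-! ### Sums of bump forms -/

/-- The differential of a convergent sum of bump forms has integral zero over every simplex. -/
theorem d_mem_kerI_of_hasSum (hgeo : BoundedGeometry K) (σ : ℕ → OrderedSimplex K (k + 1))
    (a : ℕ → ℝ) (w : SL K n k p q) (hw : HasSum (fun i => a i • bumpSL hgeo p q (σ i)) w) :
    d K n k p q r w ∈ kerI K n (k + 1) q r := by
  rw [kerI, LinearMap.mem_ker]
  ext τ
  classical
  change (if h : ∃ T : TopSimplex K n, ∀ i, τ.vertex i ∈ T.1 then _ else _) = (0 : ℝ)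
  split_ifs with h
  · have hinj : Function.Injective fun i => (⟨τ.vertex i, h.choose_spec i⟩ : h.choose.1) :=
      fun i j hij => τ.injective (Subtype.ext_iff.1 hij)
    rw [formOf_d, faceIntegral_eq_weightedIntegral]
    have h1 := hw.mapL ((weightedIntegral h.choose.1
      (fun i => ⟨τ.vertex i, h.choose_spec i⟩) 1).comp (dEvalOn p q h.choose))
    refine h1.unique ?_
    convert (hasSum_zero : HasSum (fun _ : ℕ => (0 : ℝ)) 0) using 2 with i
    rw [map_smul, ContinuousLinearMap.comp_apply, dEvalOn_bumpSL,
      weightedIntegral_one_dBumpOn _ _ _ hinj, smul_zero]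
  · rfl

/-- If `dη = d(∑ aᵢ βᵢ)`, then the supremum of `|η|` on a simplex that contains `σᵢ` is at least
a fixed multiple of `aᵢ`: on `σᵢ` the other bump forms vanish, and the weighted integral of `dβᵢ`
over `σᵢ` is a positive constant. -/
theorem exists_mul_le_norm_formOf (V : Type*) [DecidableEq V] (K : AbstractSimplicialComplex V)
    (n k : ℕ) (p q r : ℝ≥0∞) [Fact (1 ≤ p)] [Fact (1 ≤ q)] [Fact (1 ≤ r)] :
    ∃ c : ℝ, 0 < c ∧ ∀ (hgeo : BoundedGeometry K) (σ : ℕ → OrderedSimplex K (k + 1)),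
      (Function.Injective fun i => (σ i).face) → ∀ (a : ℕ → ℝ) (w : SL K n k p q),
      HasSum (fun i => a i • bumpSL hgeo p q (σ i)) w → ∀ η : SL K n k r q,
      (∀ T, dEvalOn r q T η = dEvalOn p q T w) → ∀ (i : ℕ) (T : TopSimplex K n),
      (σ i).face ⊆ T.1 → c * a i ≤ ‖formOf η T‖ := by
  obtain ⟨C, hC0, hC⟩ := exists_abs_weightedIntegral_dEvalOn_le (K := K) (n := n) (p := r)
    (q := q) (bumpWeight k) (contDiff_bumpWeight k) fun s => bumpWeight_eq_zero
  set I : ℝ := ∫ s, bumpWeight k s * bumpWeight k s with hI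
  have hIpos : 0 < I := integral_sq_bumpWeight_pos k
  refine ⟨I / (C + 1), by positivity, fun hgeo σ hσ a w hw η hη i T hT => ?_⟩
  have hv : ∀ j, (σ i).vertex j ∈ T.1 := ((σ i).face_subset_iff T.1).1 hT
  set v : Fin (k + 1 + 1) → T.1 := fun j => ⟨(σ i).vertex j, hv j⟩
  have hinj : Function.Injective v := fun j l hjl => (σ i).injective (Subtype.ext_iff.1 hjl)
  have hsum : HasSum (fun j => a j * weightedIntegral T.1 v (bumpWeight k) (dBumpOn (σ j) T))
      (weightedIntegral T.1 v (bumpWeight k) (dEvalOn p q T w)) := by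
    have h1 := hw.mapL ((weightedIntegral T.1 v (bumpWeight k)).comp (dEvalOn p q T))
    convert! h1 using 2 with j
    rw [map_smul, ContinuousLinearMap.comp_apply, dEvalOn_bumpSL, smul_eq_mul]
  have hval : weightedIntegral T.1 v (bumpWeight k) (dEvalOn p q T w) = a i * I := by
    rw [hI, ← weightedIntegral_bumpWeight_dBumpOn (σ i) T hv]
    refine hsum.unique (hasSum_single i fun j hj => ?_)
    rw [weightedIntegral_dBumpOn_of_ne (σ j) T v hinj _ fun h => hj (hσ h), mul_zero]
  have hle := hC T v η
  rw [hη, hval] at hle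
  have hle' : a i * I ≤ (C + 1) * ‖formOf η T‖ := by
    nlinarith [le_abs_self (a i * I), norm_nonneg (formOf η T)]
  rw [div_mul_eq_mul_div, div_le_iff₀ (by positivity)]
  linarith

/-- The norms of a form in `SLᵏ` on simplices containing the `σᵢ` are `p`-summable: every simplex
of top dimension contains a bounded number of the `σᵢ`. -/
theorem summable_norm_formOf (hp : p ≠ ∞) {σ : ℕ → OrderedSimplex K (k + 1)}
    (hσ : Function.Injective fun i => (σ i).face) (τ : ℕ → TopSimplex K n)
    (hτ : ∀ i, (σ i).face ⊆ (τ i).1) {j : ℕ} (η : SL K n j p q) :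
    Summable fun i => ‖formOf η (τ i)‖ ^ p.toReal := by
  classical
  have hp0 : 0 < p.toReal := ENNReal.toReal_pos (zero_lt_one.trans_le Fact.out).ne' hp
  have hs : Summable fun T : TopSimplex K n => ‖formOf η T‖ ^ p.toReal :=
    (lp.memℓp η.1.fst).summable hp0
  have h0 : ∀ T : TopSimplex K n, 0 ≤ ‖formOf η T‖ ^ p.toReal := fun T =>
    Real.rpow_nonneg (norm_nonneg (E := Form T.1 j) _) _
  refine summable_of_sum_le (c := 2 ^ (n + 1) * ∑' T, ‖formOf η T‖ ^ p.toReal)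
    (fun i => h0 (τ i)) fun t => ?_
  rw [Finset.sum_comp (fun T => ‖formOf η T‖ ^ p.toReal) τ]
  calc _ ≤ ∑ T ∈ t.image τ, 2 ^ (n + 1) * ‖formOf η T‖ ^ p.toReal := by
        refine Finset.sum_le_sum fun T _ => ?_
        rw [nsmul_eq_mul]
        refine mul_le_mul_of_nonneg_right ?_ (h0 T)
        have h1 : (t.filter fun i => τ i = T).card ≤ 2 ^ (n + 1) := by
          refine (Finset.card_le_card (Finset.monotone_filter_right t ?_)).trans
            (card_filter_face_subset_le hσ T t)
          rintro i - rfl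
          exact hτ i
        exact_mod_cast h1
    _ ≤ _ := by
        rw [← Finset.mul_sum]
        exact mul_le_mul_of_nonneg_left (hs.sum_le_tsum _ fun T _ => h0 T) (by positivity)

theorem summable_rpow_coeff_iff {P Q : ℝ} :
    (Summable fun i : ℕ => ((1 / ((i : ℝ) + 1)) ^ (1 / Q)) ^ P) ↔ 1 < P / Q := by
  rw [← Real.summable_one_div_nat_add_rpow 1]
  refine summable_congr fun i => ?_
  have hi : (0 : ℝ) < i + 1 := by positivity
  rw [← Real.rpow_mul (by positivity), abs_of_pos hi, Real.div_rpow zero_le_one hi.le,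
    Real.one_rpow, one_div_mul_eq_div]

/-- The differential of the sum of the `(1/i)^{1/(p_{k+1} - ε)} β_{σᵢ}` lies in the kernel of the
de Rham map, but is not the differential of an element of `SLᵏ` for the smaller exponent. -/
theorem exists_bumpSeries (hdim : IsPure K n) (hgeo : BoundedGeometry K) (hq : q ≠ ∞)
    (hp : p ≠ ∞) {s : ℝ≥0∞} [Fact (1 ≤ s)] (σ : ℕ → OrderedSimplex K (k + 1))
    (hσ : Function.Injective fun i => (σ i).face) {ε : ℝ} (hε : 0 < ε)
    (hεlt : ε < q.toReal - p.toReal) :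
    ∃ β : ℕ → SL K n k q q, (∀ i, IsBumpForm (σ i) (formOf (β i))) ∧
      ∃ w : SL K n k q q,
        HasSum (fun i : ℕ => (1 / ((i : ℝ) + 1)) ^ (1 / (q.toReal - ε)) • β i) w ∧
        d K n k q q s w ∈ kerI K n (k + 1) q s ∧
        ∀ η : SL K n k p q, d K n k p q s η ≠ d K n k q q s w := by
  have hp0 : 0 < p.toReal := ENNReal.toReal_pos (zero_lt_one.trans_le Fact.out).ne' hp
  have hQ : 0 < q.toReal - ε := by linarith
  set a : ℕ → ℝ := fun i => (1 / ((i : ℝ) + 1)) ^ (1 / (q.toReal - ε)) with ha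
  have ha0 : ∀ i, 0 ≤ a i := fun i => Real.rpow_nonneg (by positivity) _
  have hsum : Summable fun i => a i ^ q.toReal := by
    rw [ha, summable_rpow_coeff_iff, one_lt_div hQ]
    linarith
  have hnot : ¬ Summable fun i => a i ^ p.toReal := by
    rw [ha, summable_rpow_coeff_iff, one_lt_div hQ]
    linarith
  obtain ⟨w, hw⟩ := summable_smul_bumpSL (n := n) hgeo hq hσ a ha0 hsum
  refine ⟨fun i => bumpSL hgeo q q (σ i), fun i => isBumpForm_bumpSL hgeo (σ i), w, hw,
    d_mem_kerI_of_hasSum hgeo σ a w hw, fun η hη => hnot ?_⟩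
  obtain ⟨c, hc, hle⟩ := exists_mul_le_norm_formOf V K n k q q p
  choose τ hτ using fun i => exists_topSimplex_supset hdim (σ i)
  have hdη : ∀ T, dEvalOn p q T η = dEvalOn q q T w := fun T =>
    congrArg (fun z : SL K n (k + 1) q s => formOf z T) hη
  have h1 : Summable fun i => (c * a i) ^ p.toReal :=
    (summable_norm_formOf hp hσ τ hτ η).of_nonneg_of_le
      (fun i => Real.rpow_nonneg (mul_nonneg hc.le (ha0 i)) _) fun i =>
      Real.rpow_le_rpow (mul_nonneg hc.le (ha0 i))
        (hle hgeo σ hσ a w hw η hdη i (τ i) (hτ i)) hp0.le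
  simp only [Real.mul_rpow hc.le (ha0 _)] at h1
  exact (summable_mul_left_iff (Real.rpow_pos_of_pos hc _).ne').1 h1

theorem d_d (w : SL K n k p q) {s : ℝ≥0∞} [Fact (1 ≤ s)] :
    d K n (k + 1) q r s (d K n k p q r w) = 0 :=
  rfl

end LipDeRham

end
open LipDeRham in
theorem mainTheorem2 {V : Type*} [DecidableEq V] (K : AbstractSimplicialComplex V) (n : ℕ)
    (hdim : IsPure K n) (hgeo : BoundedGeometry K) (hnc : ¬ IsCompact (realization K))
    (p : ℕ → ℝ≥0∞) [∀ i, Fact (1 ≤ p i)] (hp : ∀ i, 1 < p i ∧ p i < ∞)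
    (k : ℕ) (hk : k + 1 ≤ n) (hpk : p k < p (k + 1)) :
    -- there is no arrow `ker 𝓘 → d(SLᵏ)` over `SLᵏ⁺¹`
    (¬ ∃ Φ : kerI K n (k + 1) (p (k + 1)) (p (k + 2)) →ₗ[ℝ]
        LinearMap.range (d K n k (p k) (p (k + 1)) (p (k + 2))).toLinearMap,
      ∀ θ, (Φ θ : SL K n (k + 1) (p (k + 1)) (p (k + 2))) = θ) ∧
    -- the explicit elements
    (∃ σ : ℕ → OrderedSimplex K (k + 1), Function.Injective fun i => (σ i).face) ∧
    (∀ σ : ℕ → OrderedSimplex K (k + 1), (Function.Injective fun i => (σ i).face) →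
      ∀ ε : ℝ, 0 < ε → ε < (p (k + 1)).toReal - (p k).toReal →
        ∃ β : ℕ → SL K n k (p (k + 1)) (p (k + 1)), (∀ i, IsBumpForm (σ i) (formOf (β i))) ∧
          ∃ w : SL K n k (p (k + 1)) (p (k + 1)),
            HasSum (fun i : ℕ => (1 / ((i : ℝ) + 1)) ^ (1 / ((p (k + 1)).toReal - ε)) • β i) w ∧
            d K n k (p (k + 1)) (p (k + 1)) (p (k + 2)) w ∈
              kerI K n (k + 1) (p (k + 1)) (p (k + 2)) ∧
            ∀ η : SL K n k (p k) (p (k + 1)),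
              d K n k (p k) (p (k + 1)) (p (k + 2)) η ≠
                d K n k (p (k + 1)) (p (k + 1)) (p (k + 2)) w) ∧
    -- the complex `ker 𝓘` has nontrivial cohomology in degree `k + 1`
    Nontrivial (KerCohomologySucc K n k p) := by
  have hseries := fun (σ : ℕ → OrderedSimplex K (k + 1))
    (hσ : Function.Injective fun i => (σ i).face) (ε : ℝ) (hε : 0 < ε)
    (hεlt : ε < (p (k + 1)).toReal - (p k).toReal) =>
    exists_bumpSeries (s := p (k + 2)) hdim hgeo (hp (k + 1)).2.ne (hp k).2.ne σ hσ hε hεlt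
  obtain ⟨σ, hσ⟩ := exists_injective_face hdim hnc hk
  have hgap : (p k).toReal < (p (k + 1)).toReal :=
    (ENNReal.toReal_lt_toReal (hp k).2.ne (hp (k + 1)).2.ne).2 hpk
  obtain ⟨-, -, w, -, hker, hne⟩ :=
    hseries σ hσ (((p (k + 1)).toReal - (p k).toReal) / 2) (by linarith) (by linarith)
  refine ⟨?_, ⟨σ, hσ⟩, hseries, ?_⟩
  · rintro ⟨Φ, hΦ⟩
    obtain ⟨η, hη⟩ := (Φ ⟨_, hker⟩).2
    exact hne η (hη.trans (hΦ ⟨_, hker⟩))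
  · refine Submodule.Quotient.nontrivial_iff.2 fun htop => ?_
    have hmem := (Submodule.eq_top_iff'.1 htop) ⟨d K n k (p (k + 1)) (p (k + 1)) (p (k + 2)) w,
      hker, d_d w⟩
    obtain ⟨η, -, hη⟩ := hmem
    exact hne η hη
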